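/- **Conventions.** Let $\mathbb k$ be a field. "Operad" means shuffle operad over $\mathbb k$ (components $\mathcal P(n)$, $n\ge1$, a unit in $\mathcal P(1)$, and elementary shuffle compositions $\alpha\circ_{i,\sigma}\beta$). The free operad $\mathcal F_V$ on generators $x\in X$ of prescribed arities has as basis the tree monomials: planar rooted trees with vertices decorated by generators, leaves labelled bijectively by $1,\dots,n$, the inputs of every vertex being ordered by the minimal leaves above them. A linear ordering of all tree monomials is *admissible* if monomials of smaller arity are smaller, and $\alpha\le\alpha'$, $\beta\le\beta'$ (with $\alpha,\alpha'$ of equal arity, $\beta,\beta'$ of equal arity) imply $\alpha\circ_{i,\sigma}\beta\le\alpha'\circ_{i,\sigma}\beta'$. Let $\mathcal P\simeq\mathcal F_V/\mathcal M$. A set $B$ of tree monomials containing all generators is a *$k$-triangular basis* of $\mathcal P$ (for a given admissible ordering) if (1) its image in $\mathcal P$ is a basis of $\mathcal P$; (2) for all $\alpha,\beta\in B$ and all $i,\sigma$, either $\alpha\circ_{i,\sigma}\beta\in B$ or all elements $\gamma\in B$ which occur in the expansion of $\alpha\circ_{i,\sigma}\beta$ modulo $\mathcal M$ satisfy $\gamma<\alpha\circ_{i,\sigma}\beta$;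 (3) a tree monomial is in $B$ if and only if, for each of its subtrees with at least one and at most $k$ vertices, the restricted tree monomial (leaves renumbered in the order of their smallest descendants) is in $B$. An associative algebra is regarded as an operad concentrated in arity $1$; the tree monomials are then the words in its generators. **Theorem.** Let $A=\bigoplus_{n\ge0}A_n$ be a graded algebra which is commutative (without signs), with homogeneous generators $x\in X$ of positive degrees $d(x)$. Let $\mathcal O_A$ be the operad with $\mathcal O_A(n)=A_{n-1}$ in which all compositions $\alpha\circ_{i,\sigma}\beta$ are given by the product of $A$. Let $k\ge2$, and let $B$ be a $k$-triangular basis of $A$ with respect to the generators $X$ and some admissible ordering of words. Define recursively a set $C$ of tree monomials in the generators $x\in X$, of arity $d(x)+1$, together with a correspondence $\psi$ from $C$ to words: the degenerate tree belongs to $C$ and corresponds to the empty word; every generator belongs to $C$ and corresponds to itself; if $\alpha,\beta\in C$, $\psi(\alpha)\psi(\beta)\in B$, and $\alpha$ has arity $m$, then $\alpha\circ_m\beta\in C$ and $\psi(\alpha\circ_m\beta)=\psi(\alpha)\psi(\beta)$. Then $\psi$ is a well-defined one-to-one correspondence between $C$ and $B$, the elements $x\in A_{d(x)}=\mathcal O_A(d(x)+1)$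 generate $\mathcal O_A$, and there is an admissible ordering of tree monomials for which $C$ is a $k$-triangular basis of $\mathcal O_A$. In particular, if $A$ has a $k$-triangular basis, so does $\mathcal O_A$. -/

import Mathlib

/-- The position data of an elementary shuffle composition `α ∘_{i,σ} β`, where `α` has `a + 1`
inputs, `β` has `b + 1` inputs and the result has `c + 1` inputs (all inputs are numbered from `0`).
The output of `β` is plugged into the input `i` of `α`.  The increasing maps `f`, `g` tell which
inputs of the result are the inputs of `α` and of `β`; the inputs of the two are disjoint and exhaust
the result, except that the label of the smallest input of `β` is the label of the input `i` of `α`.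
In terms of a shuffle `σ` (and numbering from `1`, with `m = b + 1`): `f j = j` for `j ≤ i` and
`f j = σ (m - 1 + j)` for `j > i`, whereas `g 1 = i` and `g j = σ (i + j - 1)` for `j > 1`. -/
structure Shuffle (a b c : ℕ) where
  i : Fin (a + 1)
  f : Fin (a + 1) ↪o Fin (c + 1)
  g : Fin (b + 1) ↪o Fin (c + 1)
  glue : f i = g 0
  disj : ∀ j l, f j = g l → j = i
  cover : ∀ z, (∃ j, f j = z) ∨ ∃ l, g l = z

namespace Shuffle

theorem degree_eq {a b c : ℕ} (s : Shuffle a b c) : a + b = c := by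
  have h1 : (Finset.univ.map s.f.toEmbedding) ∪ (Finset.univ.map s.g.toEmbedding)
      = Finset.univ := by
    ext z
    simpa using s.cover z
  have h2 : (Finset.univ.map s.f.toEmbedding) ∩ (Finset.univ.map s.g.toEmbedding)
      = {s.g 0} := by
    ext z
    simp only [Finset.mem_inter, Finset.mem_map, Finset.mem_univ, true_and, Finset.mem_singleton]
    constructor
    · rintro ⟨⟨j, rfl⟩, ⟨l, hl⟩⟩
      have hj : j = s.i := s.disj j l hl.symm
      subst hj
      exact s.glue
    · rintro rfl
      exact ⟨⟨s.i, s.glue⟩, ⟨0, rfl⟩⟩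
  have h3 := Finset.card_union_add_card_inter
    (Finset.univ.map s.f.toEmbedding) (Finset.univ.map s.g.toEmbedding)
  rw [h1, h2] at h3
  simp at h3
  omega

end Shuffle

theorem fin_orderEmbedding_self {n : ℕ} (f : Fin n ↪o Fin n) (j : Fin n) : f j = j := by
  have hs : Function.Surjective f := Finite.surjective_of_injective f.injective
  have h : (RelIso.ofSurjective f hs : Fin n ≃o Fin n) = OrderIso.refl _ := Subsingleton.elim _ _
  exact congrArg (fun e : Fin n ≃o Fin n => e j) h

/-- A shuffle operad over `K`, presented by its elementary shuffle compositions.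
`P n` is the component of arity degree `n`, that is of arity `n + 1`. -/
structure ShuffleOperad (K : Type*) [Field K] where
  P : ℕ → Type*
  [grp : ∀ n, AddCommGroup (P n)]
  [mod : ∀ n, Module K (P n)]
  one : P 0
  comp : ∀ {a b c : ℕ}, Shuffle a b c → P a →ₗ[K] P b →ₗ[K] P c
  comp_one : ∀ {a : ℕ} (s : Shuffle a 0 a) (x : P a), comp s x one = x
  one_comp : ∀ {b : ℕ} (s : Shuffle 0 b b) (y : P b), comp s one y = y
  /-- Sequential composition: `z` is plugged into an input of `y`. -/
  assoc_seq : ∀ {a b e ab be abe : ℕ} (s : Shuffle a b ab) (t : Shuffle ab e abe)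
    (s' : Shuffle a be abe) (t' : Shuffle b e be),
    s'.i = s.i → t.i = s.g t'.i →
    (∀ j, t.f (s.f j) = s'.f j) → (∀ l, t.f (s.g l) = s'.g (t'.f l)) →
    (∀ r, t.g r = s'.g (t'.g r)) →
    ∀ (x : P a) (y : P b) (z : P e), comp t (comp s x y) z = comp s' x (comp t' y z)
  /-- Parallel composition: `y` and `z` are plugged into two different inputs of `x`. -/
  assoc_par : ∀ {a b e ab ae abe : ℕ} (s : Shuffle a b ab) (t : Shuffle ab e abe)
    (s' : Shuffle a e ae) (t' : Shuffle ae b abe),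
    s'.i ≠ s.i → t.i = s.f s'.i → t'.i = s'.f s.i →
    (∀ j, t.f (s.f j) = t'.f (s'.f j)) → (∀ l, t.f (s.g l) = t'.g l) →
    (∀ r, t.g r = t'.f (s'.g r)) →
    ∀ (x : P a) (y : P b) (z : P e), comp t (comp s x y) z = comp t' (comp s' x z) y

attribute [instance] ShuffleOperad.grp ShuffleOperad.mod

/-- Morphisms of shuffle operads. -/
structure ShuffleOperad.Hom {K : Type*} [Field K] (P Q : ShuffleOperad K) where
  map : ∀ n, P.P n →ₗ[K] Q.P n
  map_one : map 0 P.one = Q.one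
  map_comp : ∀ {a b c : ℕ} (s : Shuffle a b c) (x : P.P a) (y : P.P b),
    map c (P.comp s x y) = Q.comp s (map a x) (map b y)

/-- Planar rooted trees with leaves labelled by `L`, whose vertices are decorated by elements of `X`;
a vertex decorated by `x` has `d x + 1` inputs. -/
inductive OpTree (X : Type*) (d : X → ℕ) (L : Type*) where
  | leaf (a : L) : OpTree X d L
  | node (x : X) (t : Fin (d x + 1) → OpTree X d L) : OpTree X d L

namespace OpTree

variable {X : Type*} {d : X → ℕ} {L M N : Type*}

/-- Substitution of trees for the leaves. -/
def bind : OpTree X d L → (L → OpTree X d M) → OpTree X d M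
  | leaf a, h => h a
  | node x t, h => node x fun j => (t j).bind h

/-- Relabelling of the leaves. -/
def map (u : L → M) (t : OpTree X d L) : OpTree X d M := t.bind fun a => leaf (u a)

/-- The leaf labels, from left to right. -/
def leaves : OpTree X d L → List L
  | leaf a => [a]
  | node _ t => (List.ofFn fun j => (t j).leaves).flatten

/-- The number of (internal) vertices. -/
def numVertices : OpTree X d L → ℕ
  | leaf _ => 0
  | node _ t => 1 + ∑ j, (t j).numVertices

/-- The minimal leaf of `t` is smaller than the minimal leaf of `u`. -/
def Precedes [LT L] (t u : OpTree X d L) : Prop := ∃ a ∈ t.leaves, ∀ b ∈ u.leaves, a < b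

/-- The inputs of every vertex are ordered by their minimal leaves. -/
def IsCanonical [LT L] : OpTree X d L → Prop
  | leaf _ => True
  | node _ t => (∀ j l, j < l → (t j).Precedes (t l)) ∧ ∀ j, (t j).IsCanonical

/-- `IsBranch u t`: the tree `u` consists of everything above some edge of `t`. -/
inductive IsBranch : OpTree X d L → OpTree X d L → Prop
  | refl (t : OpTree X d L) : IsBranch t t
  | child (u : OpTree X d L) (x : X) (t : Fin (d x + 1) → OpTree X d L) (j : Fin (d x + 1)) :
      IsBranch u (t j) → IsBranch u (node x t)

theorem bind_assoc (t : OpTree X d L) (h : L → OpTree X d M) (k : M → OpTree X d N) :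
    (t.bind h).bind k = t.bind fun a => (h a).bind k := by
  induction t with
  | leaf a => rfl
  | node x t ih => simp only [bind, ih]

theorem bind_leaf (t : OpTree X d L) : t.bind leaf = t := by
  induction t with
  | leaf a => rfl
  | node x t ih => simp only [bind, ih]

theorem leaves_bind (t : OpTree X d L) (h : L → OpTree X d M) :
    (t.bind h).leaves = t.leaves.flatMap fun a => (h a).leaves := by
  induction t with
  | leaf a => simp [bind, leaves]
  | node x t ih =>
    simp only [bind, leaves, ih, List.flatMap_def, List.map_flatten, List.map_ofFn,
      List.flatten_flatten]
    rfl

theorem leaves_map (t : OpTree X d L) (u : L → M) : (t.map u).leaves = t.leaves.map u := by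
  rw [map, leaves_bind]
  simp only [leaves]
  induction t.leaves with
  | nil => rfl
  | cons a l ih => simp [ih]

theorem isCanonical_bind [Preorder L] [Preorder M] (t : OpTree X d L) (h : L → OpTree X d M)
    (f : L → M) (hf : StrictMono f) (hmem : ∀ a, f a ∈ (h a).leaves)
    (hmin : ∀ a, ∀ b ∈ (h a).leaves, f a ≤ b) (hc : ∀ a, (h a).IsCanonical)
    (ht : t.IsCanonical) : (t.bind h).IsCanonical := by
  induction t with
  | leaf a => exact hc a
  | node x t ih =>
    refine ⟨fun j l hjl => ?_, fun j => ih j (ht.2 j)⟩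
    obtain ⟨a, ha, hab⟩ := ht.1 j l hjl
    refine ⟨f a, ?_, fun b hb => ?_⟩
    · rw [leaves_bind]
      exact List.mem_flatMap.2 ⟨a, ha, hmem a⟩
    · rw [leaves_bind] at hb
      obtain ⟨b', hb', hb''⟩ := List.mem_flatMap.1 hb
      exact lt_of_lt_of_le (hf (hab b' hb')) (hmin b' b hb'')

end OpTree

/-- Tree monomials of arity degree `n`: decorated trees with `n + 1` leaves labelled bijectively by
`Fin (n + 1)`, in their canonical planar representation. -/
@[ext] structure TreeMonomial (X : Type*) (d : X → ℕ) (n : ℕ) where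
  tree : OpTree X d (Fin (n + 1))
  nodup : tree.leaves.Nodup
  mem_leaves : ∀ a, a ∈ tree.leaves
  canonical : tree.IsCanonical

namespace TreeMonomial

variable {X : Type*} {d : X → ℕ}

/-- The degenerate tree. -/
def unit : TreeMonomial X d 0 where
  tree := .leaf 0
  nodup := by simp [OpTree.leaves]
  mem_leaves a := by simp [OpTree.leaves, Fin.eq_zero a]
  canonical := trivial

/-- The corolla with vertex `x`. -/
def corolla (x : X) : TreeMonomial X d (d x) where
  tree := .node x fun j => .leaf j
  nodup := by
    have h : (List.ofFn fun j : Fin (d x + 1) => [j]).flatten = List.finRange (d x + 1) := by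
      rw [List.ofFn_eq_map, ← List.flatMap_def, List.flatMap_singleton']
    simp only [OpTree.leaves, h]
    exact List.nodup_finRange _
  mem_leaves a := List.mem_flatten.2 ⟨[a], List.mem_ofFn.2 ⟨a, rfl⟩, by simp⟩
  canonical := ⟨fun j l h => ⟨j, by simp [OpTree.leaves], by simpa [OpTree.leaves] using h⟩,
    fun _ => trivial⟩

/-- What is grafted onto the leaves of the first tree in a shuffle composition. -/
def graft {a b c : ℕ} (s : Shuffle a b c) (β : TreeMonomial X d b) (j : Fin (a + 1)) :
    OpTree X d (Fin (c + 1)) :=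
  if j = s.i then β.tree.map s.g else .leaf (s.f j)

theorem mem_leaves_graft {a b c : ℕ} (s : Shuffle a b c) (β : TreeMonomial X d b)
    (j : Fin (a + 1)) (z : Fin (c + 1)) :
    z ∈ (graft s β j).leaves ↔ (j = s.i ∧ ∃ l, s.g l = z) ∨ (j ≠ s.i ∧ s.f j = z) := by
  unfold graft
  split_ifs with h
  · simp [h, OpTree.leaves_map, β.mem_leaves]
  · simp [h, OpTree.leaves, eq_comm]

/-- The shuffle composition of tree monomials. -/
def comp {a b c : ℕ} (s : Shuffle a b c) (α : TreeMonomial X d a) (β : TreeMonomial X d b) :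
    TreeMonomial X d c where
  tree := α.tree.bind (graft s β)
  nodup := by
    rw [OpTree.leaves_bind, List.nodup_flatMap]
    constructor
    · intro j _
      unfold graft
      split_ifs with h
      · rw [OpTree.leaves_map]
        exact β.nodup.map s.g.injective
      · simp [OpTree.leaves]
    · refine α.nodup.imp ?_
      intro j l hjl z hz hz'
      rw [mem_leaves_graft] at hz hz'
      rcases hz with ⟨h1, l1, h2⟩ | ⟨h1, h2⟩ <;> rcases hz' with ⟨h3, l3, h4⟩ | ⟨h3, h4⟩
      · exact hjl (h1.trans h3.symm)
      · exact h3 (s.disj l l1 (h4.trans h2.symm))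
      · exact h1 (s.disj j l3 (h2.trans h4.symm))
      · exact hjl (s.f.injective (h2.trans h4.symm))
  mem_leaves z := by
    rw [OpTree.leaves_bind, List.mem_flatMap]
    rcases s.cover z with ⟨j, hj⟩ | ⟨l, hl⟩
    · refine ⟨j, α.mem_leaves j, ?_⟩
      rw [mem_leaves_graft]
      by_cases h : j = s.i
      · refine Or.inl ⟨h, 0, ?_⟩
        rw [← s.glue, ← h, hj]
      · exact Or.inr ⟨h, hj⟩
    · exact ⟨s.i, α.mem_leaves _, (mem_leaves_graft s β s.i z).2 (Or.inl ⟨rfl, l, hl⟩)⟩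
  canonical := by
    refine OpTree.isCanonical_bind _ _ s.f s.f.strictMono ?_ ?_ ?_ α.canonical
    · intro j
      rw [mem_leaves_graft]
      by_cases h : j = s.i
      · exact Or.inl ⟨h, 0, by rw [h, s.glue]⟩
      · exact Or.inr ⟨h, rfl⟩
    · intro j z hz
      rw [mem_leaves_graft] at hz
      rcases hz with ⟨h, l, rfl⟩ | ⟨_, rfl⟩
      · rw [h, s.glue]
        exact s.g.monotone (Fin.zero_le l)
      · exact le_rfl
    · intro j
      unfold graft
      split_ifs with h
      · exact OpTree.isCanonical_bind _ _ s.g s.g.strictMono (by simp [OpTree.leaves])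
          (by simp [OpTree.leaves]) (fun _ => trivial) β.canonical
      · trivial

theorem comp_unit {a : ℕ} (s : Shuffle a 0 a) (α : TreeMonomial X d a) : comp s α unit = α := by
  ext1
  have h : graft s (unit : TreeMonomial X d 0) = OpTree.leaf := by
    funext j
    unfold graft
    split_ifs with h
    · simp only [unit, OpTree.map, OpTree.bind]
      rw [← s.glue, fin_orderEmbedding_self, h]
    · rw [fin_orderEmbedding_self]
  simp only [comp, h, OpTree.bind_leaf]

theorem unit_comp {b : ℕ} (s : Shuffle 0 b b) (β : TreeMonomial X d b) : comp s unit β = β := by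
  ext1
  have h : (0 : Fin (0 + 1)) = s.i := (Fin.eq_zero s.i).symm
  simp only [comp, unit, OpTree.bind, graft, if_pos h, OpTree.map, fin_orderEmbedding_self]
  exact OpTree.bind_leaf _

theorem comp_assoc_seq {a b e ab be abe : ℕ} (s : Shuffle a b ab) (t : Shuffle ab e abe)
    (s' : Shuffle a be abe) (t' : Shuffle b e be)
    (h1 : s'.i = s.i) (h2 : t.i = s.g t'.i)
    (h3 : ∀ j, t.f (s.f j) = s'.f j) (h4 : ∀ l, t.f (s.g l) = s'.g (t'.f l))
    (h5 : ∀ r, t.g r = s'.g (t'.g r))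
    (x : TreeMonomial X d a) (y : TreeMonomial X d b) (z : TreeMonomial X d e) :
    comp t (comp s x y) z = comp s' x (comp t' y z) := by
  ext1
  simp only [comp, OpTree.bind_assoc]
  congr 1
  funext j
  by_cases hj : j = s.i
  · simp only [graft, hj, h1, if_true, OpTree.map, OpTree.bind_assoc, OpTree.bind]
    congr 1
    funext l
    by_cases hl : l = t'.i
    · simp [hl, h2, OpTree.bind_assoc, OpTree.bind, h5]
    · have : s.g l ≠ t.i := fun h => hl (s.g.injective (h.trans h2))
      simp [hl, this, OpTree.bind, h4]
  · have : s.f j ≠ t.i := fun h => hj (s.disj j _ (h.trans h2))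
    simp [graft, hj, h1, this, OpTree.bind, h3]

theorem comp_assoc_par {a b e ab ae abe : ℕ} (s : Shuffle a b ab) (t : Shuffle ab e abe)
    (s' : Shuffle a e ae) (t' : Shuffle ae b abe)
    (h1 : s'.i ≠ s.i) (h2 : t.i = s.f s'.i) (h2' : t'.i = s'.f s.i)
    (h3 : ∀ j, t.f (s.f j) = t'.f (s'.f j)) (h4 : ∀ l, t.f (s.g l) = t'.g l)
    (h5 : ∀ r, t.g r = t'.f (s'.g r))
    (x : TreeMonomial X d a) (y : TreeMonomial X d b) (z : TreeMonomial X d e) :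
    comp t (comp s x y) z = comp t' (comp s' x z) y := by
  ext1
  simp only [comp, OpTree.bind_assoc]
  congr 1
  funext j
  by_cases hj : j = s.i
  · subst hj
    have hk : s.i ≠ s'.i := fun h => h1 h.symm
    have hg : ∀ l, s.g l ≠ t.i := fun l h => h1 (s.disj _ _ (h2.symm.trans h.symm))
    simp [graft, hk, OpTree.map, OpTree.bind_assoc, OpTree.bind, h2', hg, h4]
  · by_cases hj' : j = s'.i
    · subst hj'
      have hg : ∀ l, s'.g l ≠ t'.i := fun l h => h1 (s'.disj _ _ (h2'.symm.trans h.symm)).symm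
      simp [graft, h1, OpTree.map, OpTree.bind_assoc, OpTree.bind, h2, hg, h5]
    · have hf : s.f j ≠ t.i := fun h => hj' (s.f.injective (h.trans h2))
      have hf' : s'.f j ≠ t'.i := fun h => hj (s'.f.injective (h.trans h2'))
      simp [graft, hj, hj', OpTree.bind, hf, hf', h3]

/-- `β` is the tree monomial obtained by restricting `α` to a subtree: the root of the subtree is the
root of a branch `u` of `α`, the branch is obtained from `β` by attaching further branches to its
leaves, and the leaves of `β` are numbered in the order of their smallest descendants. -/
def IsRestriction {m n : ℕ} (β : TreeMonomial X d m) (α : TreeMonomial X d n) : Prop :=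
  ∃ u, OpTree.IsBranch u α.tree ∧ ∃ h : Fin (m + 1) → OpTree X d (Fin (n + 1)),
    u = β.tree.bind h ∧ ∀ j l, j < l → (h j).Precedes (h l)

end TreeMonomial

theorem linearCombination_comp_single {K : Type*} [Field K] {X : Type*} {d : X → ℕ} {a b c : ℕ}
    (s : Shuffle a b c) (α : TreeMonomial X d a) (β : TreeMonomial X d b) (r r' : K) :
    Finsupp.linearCombination K (fun α => Finsupp.lmapDomain K K (TreeMonomial.comp s α))
      (Finsupp.single α r) (Finsupp.single β r') = Finsupp.single (α.comp s β) (r * r') := by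
  rw [Finsupp.linearCombination_single, LinearMap.smul_apply, Finsupp.lmapDomain_apply,
    Finsupp.mapDomain_single, Finsupp.smul_single, smul_eq_mul]

/-- The free shuffle operad on generators `x : X` of arity `d x + 1`, with the basis of tree
monomials. -/
noncomputable def freeOperad (K : Type*) [Field K] (X : Type*) (d : X → ℕ) : ShuffleOperad K where
  P n := TreeMonomial X d n →₀ K
  one := Finsupp.single TreeMonomial.unit 1
  comp s := Finsupp.linearCombination K fun α => Finsupp.lmapDomain K K (TreeMonomial.comp s α)
  comp_one s x := by
    induction x using Finsupp.induction_linear with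
    | zero => simp
    | add x y hx hy => simp only [map_add, LinearMap.add_apply, hx, hy]
    | single α r => simp [Finsupp.linearCombination_single, TreeMonomial.comp_unit]
  one_comp s y := by
    have h : TreeMonomial.comp s (TreeMonomial.unit : TreeMonomial X d 0) = id :=
      funext fun β => TreeMonomial.unit_comp s β
    simp [Finsupp.linearCombination_single, h]
  assoc_seq s t s' t' h1 h2 h3 h4 h5 x y z := by
    induction x using Finsupp.induction_linear with
    | zero => simp
    | add x x' hx hx' => simp only [map_add, LinearMap.add_apply, hx, hx']
    | single α r =>
      induction y using Finsupp.induction_linear with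
      | zero => simp
      | add y y' hy hy' => simp only [map_add, LinearMap.add_apply, hy, hy']
      | single β r' =>
        induction z using Finsupp.induction_linear with
        | zero => simp
        | add z z' hz hz' => simp only [map_add, hz, hz']
        | single γ r'' =>
          simp only [linearCombination_comp_single, mul_assoc,
            TreeMonomial.comp_assoc_seq s t s' t' h1 h2 h3 h4 h5]
  assoc_par s t s' t' h1 h2 h2' h3 h4 h5 x y z := by
    induction x using Finsupp.induction_linear with
    | zero => simp
    | add x x' hx hx' => simp only [map_add, LinearMap.add_apply, hx, hx']
    | single α r =>
      induction y using Finsupp.induction_linear with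
      | zero => simp
      | add y y' hy hy' => simp only [map_add, LinearMap.add_apply, hy, hy']
      | single β r' =>
        induction z using Finsupp.induction_linear with
        | zero => simp
        | add z z' hz hz' => simp only [map_add, LinearMap.add_apply, hz, hz']
        | single γ r'' =>
          simp only [linearCombination_comp_single, mul_assoc, mul_comm r' r'',
            TreeMonomial.comp_assoc_par s t s' t' h1 h2 h2' h3 h4 h5]

/-- Admissible orderings of tree monomials. -/
structure IsAdmissible {X : Type*} {d : X → ℕ} (o : LinearOrder (Σ n, TreeMonomial X d n)) :
    Prop where
  lt_of_arity_lt : ∀ {a b : ℕ} (α : TreeMonomial X d a) (β : TreeMonomial X d b),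
    a < b → o.lt ⟨a, α⟩ ⟨b, β⟩
  comp_le_comp : ∀ {a b c : ℕ} (s : Shuffle a b c) (α α' : TreeMonomial X d a)
    (β β' : TreeMonomial X d b), o.le ⟨a, α⟩ ⟨a, α'⟩ → o.le ⟨b, β⟩ ⟨b, β'⟩ →
    o.le ⟨c, α.comp s β⟩ ⟨c, α'.comp s β'⟩

/-- `B` is a `k`-triangular basis, with respect to the ordering `o`, of the operad `P` presented by
the morphism `φ` as a quotient of a free operad. -/
structure IsTriangularBasis {K : Type*} [Field K] {X : Type*} {d : X → ℕ} {P : ShuffleOperad K}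
    (φ : (freeOperad K X d).Hom P) (o : LinearOrder (Σ n, TreeMonomial X d n)) (k : ℕ)
    (B : ∀ n, Set (TreeMonomial X d n)) : Prop where
  corolla_mem : ∀ x, TreeMonomial.corolla x ∈ B (d x)
  linearIndependent : ∀ n,
    LinearIndependent K fun α : B n => φ.map n (Finsupp.single (α : TreeMonomial X d n) (1 : K))
  span_eq_top : ∀ n, Submodule.span K
    (Set.range fun α : B n => φ.map n (Finsupp.single (α : TreeMonomial X d n) (1 : K))) = ⊤
  /-- `e` is the expansion of the composition with respect to the basis. -/
  triangular : ∀ {a b c : ℕ} (s : Shuffle a b c) (α : TreeMonomial X d a) (β : TreeMonomial X d b),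
    α ∈ B a → β ∈ B b → α.comp s β ∈ B c ∨
      ∃ e : TreeMonomial X d c →₀ K, (∀ γ ∈ e.support, γ ∈ B c) ∧
        φ.map c (Finsupp.single (α.comp s β) (1 : K)) = φ.map c e ∧
        ∀ γ ∈ e.support, o.lt ⟨c, γ⟩ ⟨c, α.comp s β⟩
  mem_iff : ∀ {n : ℕ} (α : TreeMonomial X d n), α ∈ B n ↔
    ∀ {m : ℕ} (β : TreeMonomial X d m), β.IsRestriction α →
      1 ≤ β.tree.numVertices → β.tree.numVertices ≤ k → β ∈ B m

/-- An associative algebra as an operad concentrated in arity `1`. -/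
def unaryOperad (K A : Type*) [Field K] [Ring A] [Algebra K A] : ShuffleOperad K where
  P n := (if n = 0 then ⊤ else ⊥ : Submodule K A)
  one := ⟨1, by simp⟩
  comp {a b c} s := LinearMap.mk₂ K
    (fun x y => ⟨(x : A) * (y : A), by
      have hs := s.degree_eq
      by_cases hc : c = 0
      · simp [hc]
      · obtain ⟨x, hx⟩ := x
        obtain ⟨y, hy⟩ := y
        by_cases ha : a = 0
        · have hb : b ≠ 0 := by omega
          simp only [hb, if_false, Submodule.mem_bot] at hy
          simp [hy]
        · simp only [ha, if_false, Submodule.mem_bot] at hx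
          simp [hx]⟩)
    (fun x x' y => Subtype.ext (by simp [add_mul]))
    (fun r x y => Subtype.ext (by simp))
    (fun x y y' => Subtype.ext (by simp [mul_add]))
    (fun r x y => Subtype.ext (by simp))
  comp_one s x := Subtype.ext (by simp)
  one_comp s y := Subtype.ext (by simp)
  assoc_seq s t s' t' _ _ _ _ _ x y z := Subtype.ext (by simp [mul_assoc])
  assoc_par {a _ _ _ _ _} s t s' t' h _ _ _ _ _ x y z := Subtype.ext (by
    have ha : a ≠ 0 := by
      rintro rfl
      exact h ((Fin.eq_zero _).trans (Fin.eq_zero _).symm)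
    obtain ⟨x, hx⟩ := x
    simp only [ha, if_false, Submodule.mem_bot] at hx
    simp [hx])

/-- The operad of a (strictly) commutative graded algebra `A = ⨁ₙ 𝒜 n`: its component of arity
`n + 1` is `𝒜 n`, and all compositions are given by the product of `A`. -/
def commOperad {K A : Type*} [Field K] [CommRing A] [Algebra K A] (𝒜 : ℕ → Submodule K A)
    [GradedAlgebra 𝒜] : ShuffleOperad K where
  P n := 𝒜 n
  one := ⟨1, SetLike.GradedOne.one_mem⟩
  comp s := LinearMap.mk₂ K
    (fun x y => ⟨(x : A) * (y : A), s.degree_eq ▸ SetLike.GradedMul.mul_mem x.2 y.2⟩)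
    (fun x x' y => Subtype.ext (by simp [add_mul]))
    (fun r x y => Subtype.ext (by simp))
    (fun x y y' => Subtype.ext (by simp [mul_add]))
    (fun r x y => Subtype.ext (by simp))
  comp_one s x := Subtype.ext (by simp)
  one_comp s y := Subtype.ext (by simp)
  assoc_seq s t s' t' _ _ _ _ _ x y z := Subtype.ext (by simp [mul_assoc])
  assoc_par s t s' t' _ _ _ _ _ _ x y z := Subtype.ext (by simp [mul_right_comm])

/-- Words in the letters `X`, i.e. the tree monomials of arity `1` in unary generators `X`. -/
abbrev Word (X : Type*) : Type _ := TreeMonomial X (fun _ => 0) 0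

/-- `IsRightmost B α w`: the tree monomial `α` corresponds to the word `w ∈ B`; the correspondence is
built recursively, the product of two words corresponding to the composition at the last input. -/
inductive IsRightmost {X : Type*} {d : X → ℕ} (B : Set (Word X)) :
    ∀ {n : ℕ}, TreeMonomial X d n → Word X → Prop
  | unit : IsRightmost B TreeMonomial.unit TreeMonomial.unit
  | corolla (x : X) : IsRightmost B (TreeMonomial.corolla x) (TreeMonomial.corolla x)
  | comp {a b c : ℕ} (s : Shuffle a b c) (hs : s.i = Fin.last a) (s₀ : Shuffle 0 0 0)
      (α : TreeMonomial X d a) (β : TreeMonomial X d b) (u v : Word X) :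
      IsRightmost B α u → IsRightmost B β v → u.comp s₀ v ∈ B →
      IsRightmost B (α.comp s β) (u.comp s₀ v)

/-- The set of all tree monomials that correspond to words from `B`. -/
def rightmostSet {X : Type*} (d : X → ℕ) (B : Set (Word X)) (n : ℕ) : Set (TreeMonomial X d n) :=
  {α | ∃ w, IsRightmost B α w}

/-! The trees in `C` are right combs: every vertex but the root sits on the last input of its
parent. In a canonical right comb the leaves increase from left to right, so the comb is determined
by its word of decorations (`eq_of_isRightComb`), and every word has a comb. As `B` is closed under
subwords by condition (3), `C` consists exactly of the combs whose word lies in `B`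
(`mem_rightmostSet_iff`); this is the correspondence.

Since `A` is commutative, the value of a tree monomial is the product of its decorations, whatever
its shape. The combs in `C` thus have the same values as the words in `B`, and passing to
homogeneous components gives a basis of each component of the operad. For condition (3), being a
right comb can be tested on subtrees with two vertices, which is where `2 ≤ k` enters; subtrees of a
comb are the combs of its subwords, so the rest is condition (3) for `B`.

The ordering must do two things: combs of equal arity compare as their words (`lt_of_isRightComb`),
and a composition of two combs is never below the comb with the concatenated word
(`le_comp_of_isRightComb`). A tree is encoded by its leaves from left to right, each with a `Turn`:
the number of edges below it that are not at a last input, then the letters collected since the last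
such edge. Arities are compared first, then these keys lexicographically. In a comb every leaf but
the last has the turn `⟨1, 1⟩`, and the last one carries the whole word; grafting a comb elsewhere
produces a leaf with `left = 2`. The key determines the tree (`key_injective`), and composition is
monotone (`comp_le_comp_left`, `comp_le_comp_right`).

For triangularity, a composition of two combs has the value of the comb of the concatenated word,
which is not larger. If that word is in `B`, this comb is the expansion; otherwise the expansion of
the word in `A`, cut down to its homogeneous component, becomes a combination of smaller combs
(`triangular_rightmostSet`). -/

/-! ### Leaves, branches and canonical labellings -/

namespace OpTree

variable {X : Type*} {d : X → ℕ} {L M N : Type*}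

theorem leaves_ne_nil (t : OpTree X d L) : t.leaves ≠ [] := by
  induction t with
  | leaf a => simp [leaves]
  | node x t ih =>
    simp only [leaves, ne_eq, List.flatten_eq_nil_iff, List.mem_ofFn, not_forall]
    exact ⟨_, ⟨0, rfl⟩, ih 0⟩

theorem mem_leaves_node {x : X} {t : Fin (d x + 1) → OpTree X d L} {a : L} :
    a ∈ (node x t).leaves ↔ ∃ j, a ∈ (t j).leaves := by
  simp only [leaves, List.mem_flatten, List.mem_ofFn, exists_exists_eq_and]

theorem leaves_node_eq_append (x : X) (t : Fin (d x + 1) → OpTree X d L) :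
    (node x t).leaves =
      (List.ofFn fun j : Fin (d x) => (t j.castSucc).leaves).flatten ++ (t (Fin.last _)).leaves := by
  rw [leaves, List.ofFn_succ', List.concat_eq_append, List.flatten_append]
  simp

theorem bind_congr {t : OpTree X d L} {h k : L → OpTree X d M} (e : ∀ a ∈ t.leaves, h a = k a) :
    t.bind h = t.bind k := by
  induction t with
  | leaf a => exact e a (by simp [leaves])
  | node x t ih =>
    simp only [bind]
    congr 1
    funext j
    exact ih j fun a ha => e a (mem_leaves_node.2 ⟨j, ha⟩)

theorem map_bind (t : OpTree X d L) (u : L → M) (h : M → OpTree X d N) :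
    (t.map u).bind h = t.bind fun a => h (u a) := by
  simp only [map, bind_assoc, bind]

theorem numVertices_map (t : OpTree X d L) (u : L → M) :
    (t.map u).numVertices = t.numVertices := by
  induction t with
  | leaf a => rfl
  | node x t ih =>
    simp only [map] at ih
    simp only [map, bind, numVertices, ih]

/-- In a canonical tree, the leftmost leaf is the minimal one. -/
theorem IsCanonical.exists_leaves_eq_cons [Preorder L] {t : OpTree X d L} (ht : t.IsCanonical) :
    ∃ a l, t.leaves = a :: l ∧ ∀ b ∈ t.leaves, a ≤ b := by
  induction t with
  | leaf a => exact ⟨a, [], rfl, by simp [leaves]⟩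
  | node x t ih =>
    obtain ⟨a, l, h0, hmin⟩ := ih 0 (ht.2 0)
    refine ⟨a, l ++ (List.ofFn fun j : Fin (d x) => (t j.succ).leaves).flatten, ?_, ?_⟩
    · simp [leaves, List.ofFn_succ, h0]
    · intro b hb
      obtain ⟨j, hj⟩ := mem_leaves_node.1 hb
      rcases eq_or_ne j 0 with rfl | hj0
      · exact hmin b hj
      · obtain ⟨c, hc, hcb⟩ := ht.1 0 j (Fin.pos_of_ne_zero hj0)
        exact (hmin c hc).trans (hcb b hj).le

theorem IsCanonical.of_bind [LT M] {t : OpTree X d L} {h : L → OpTree X d M}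
    (hc : (t.bind h).IsCanonical) : ∀ a ∈ t.leaves, (h a).IsCanonical := by
  induction t with
  | leaf a => simpa [leaves, bind] using hc
  | node x t ih =>
    intro a ha
    obtain ⟨j, hj⟩ := mem_leaves_node.1 ha
    exact ih j (hc.2 j) a hj

/-- Renaming the grafted trees in the order of their minimal leaves keeps a tree canonical. -/
theorem IsCanonical.map_of_bind [Preorder M] [LT N] {t : OpTree X d L} {h : L → OpTree X d M}
    (r : L → M) (u : L → N) (hmem : ∀ a ∈ t.leaves, r a ∈ (h a).leaves)
    (hmin : ∀ a ∈ t.leaves, ∀ b ∈ (h a).leaves, r a ≤ b)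
    (hu : ∀ a ∈ t.leaves, ∀ b ∈ t.leaves, r a < r b → u a < u b)
    (hc : (t.bind h).IsCanonical) : (t.map u).IsCanonical := by
  induction t with
  | leaf a => trivial
  | node x t ih =>
    have hsub : ∀ {j a}, a ∈ (t j).leaves → a ∈ (node x t).leaves :=
      fun {j a} ha => mem_leaves_node.2 ⟨j, ha⟩
    refine ⟨fun j l hjl => ?_, fun j => ih j (fun a ha => hmem a (hsub ha))
      (fun a ha => hmin a (hsub ha)) (fun a ha b hb => hu a (hsub ha) b (hsub hb)) (hc.2 j)⟩
    obtain ⟨z, hz, hzl⟩ := hc.1 j l hjl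
    rw [leaves_bind, List.mem_flatMap] at hz
    obtain ⟨a, ha, haz⟩ := hz
    refine ⟨u a, ?_, fun b hb => ?_⟩
    · have := leaves_map (t j) u
      rw [map] at this
      rw [this]
      exact List.mem_map_of_mem ha
    · have := leaves_map (t l) u
      rw [map] at this
      rw [this, List.mem_map] at hb
      obtain ⟨c, hc', rfl⟩ := hb
      refine hu a (hsub ha) c (hsub hc') ((hmin a (hsub ha) z haz).trans_lt (hzl _ ?_))
      rw [leaves_bind, List.mem_flatMap]
      exact ⟨c, hc', hmem c (hsub hc')⟩

theorem IsBranch.isCanonical [LT L] {u t : OpTree X d L} (h : IsBranch u t)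
    (ht : t.IsCanonical) : u.IsCanonical := by
  induction h with
  | refl => exact ht
  | child x t j _ ih => exact ih (ht.2 j)

theorem IsBranch.leaves_sublist {u t : OpTree X d L} (h : IsBranch u t) :
    u.leaves.Sublist t.leaves := by
  induction h with
  | refl => exact List.Sublist.refl _
  | child x t j _ ih =>
    exact ih.trans (List.sublist_flatten_of_mem (List.mem_ofFn.2 ⟨j, rfl⟩))

theorem IsBranch.trans {u t r : OpTree X d L} (h : IsBranch u t) (h' : IsBranch t r) :
    IsBranch u r := by
  induction h' with
  | refl => exact h
  | child x r j _ ih => exact .child u x r j ih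

/-- The decorations of the vertices, in preorder. -/
def letters : OpTree X d L → List X
  | leaf _ => []
  | node x t => x :: (List.ofFn fun j => (t j).letters).flatten

/-- A vertex `x` trades one leaf for `d x + 1`. Thus the arity degree is the total degree of the
decorations, which matches the grading of the algebra. -/
theorem length_leaves (t : OpTree X d L) : t.leaves.length = (t.letters.map d).sum + 1 := by
  induction t with
  | leaf a => rfl
  | node x t ih =>
    simp only [leaves, letters, List.length_flatten, List.map_ofFn, List.map_cons, List.map_flatten,
      List.sum_cons, List.sum_flatten, List.sum_ofFn, Function.comp_apply, ih,
      Finset.sum_add_distrib, Finset.sum_const, Finset.card_univ, Fintype.card_fin]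
    simp
    omega

/-- Grafting interleaves the letters of the grafted trees with those of `t`, so commutativity is
essential. -/
theorem prod_letters_bind {A : Type*} [CommMonoid A] (v : X → A) (t : OpTree X d L)
    (h : L → OpTree X d M) : ((t.bind h).letters.map v).prod =
      (t.letters.map v).prod * (t.leaves.map fun a => ((h a).letters.map v).prod).prod := by
  induction t with
  | leaf a => simp [bind, letters, leaves]
  | node x t ih =>
    simp only [bind, leaves, letters, List.map_ofFn, List.map_cons, List.map_flatten,
      List.prod_cons, List.prod_flatten, List.prod_ofFn, Function.comp_apply, ih,
      Finset.prod_mul_distrib, mul_assoc]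

/-! ### Right combs -/

/-- The tree is a right comb: every vertex but the root is attached to the last input of another
vertex.  The list consists of the decorations, starting from the root. -/
inductive IsRightComb : OpTree X d L → List X → Prop
  | leaf (a : L) : IsRightComb (leaf a) []
  | node (x : X) (t : Fin (d x + 1) → OpTree X d L) (l : List X)
      (h : ∀ j, j ≠ Fin.last (d x) → ∃ a, t j = .leaf a) (hl : IsRightComb (t (Fin.last _)) l) :
      IsRightComb (node x t) (x :: l)

namespace IsRightComb

theorem letters_eq {t : OpTree X d L} {l : List X} (h : IsRightComb t l) : t.letters = l := by
  induction h with
  | leaf a => rfl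
  | node x t l h _ ih =>
    have : (List.ofFn fun j : Fin (d x) => (t j.castSucc).letters).flatten = [] := by
      rw [List.flatten_eq_nil_iff]
      intro m hm
      obtain ⟨j, rfl⟩ := List.mem_ofFn.1 hm
      obtain ⟨a, ha⟩ := h j.castSucc (Fin.castSucc_lt_last j).ne
      simp [ha, letters]
    rw [letters, List.ofFn_succ', List.concat_eq_append, List.flatten_append, this, ih]
    simp

theorem numVertices_eq {t : OpTree X d L} {l : List X} (h : IsRightComb t l) :
    t.numVertices = l.length := by
  induction h with
  | leaf a => rfl
  | node x t l h _ ih =>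
    have : ∀ j : Fin (d x), (t j.castSucc).numVertices = 0 := fun j => by
      obtain ⟨a, ha⟩ := h j.castSucc (Fin.castSucc_lt_last j).ne
      simp [ha, numVertices]
    simp [numVertices, Fin.sum_univ_castSucc, this, ih, add_comm]

/-- Along the spine branches are suffixes of the word; any other branch is a single leaf, with the
empty word. -/
theorem of_isBranch {u t : OpTree X d L} (hu : IsBranch u t) :
    ∀ {l : List X}, IsRightComb t l → ∃ l', l' <:+ l ∧ IsRightComb u l' := by
  induction hu with
  | refl => exact fun h => ⟨_, List.suffix_refl _, h⟩
  | child x t j _ ih =>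
    intro l h
    cases h with
    | node _ _ l h hl =>
      by_cases hj : j = Fin.last _
      · subst hj
        obtain ⟨l', hl', hu'⟩ := ih hl
        exact ⟨l', hl'.trans (List.suffix_cons _ _), hu'⟩
      · obtain ⟨a, ha⟩ := h j hj
        obtain ⟨l', hl', hu'⟩ := ih (ha ▸ leaf a)
        exact ⟨l', hl'.trans List.nil_suffix, hu'⟩

theorem of_bind {t : OpTree X d L} {h : L → OpTree X d M} :
    ∀ {l : List X}, IsRightComb (t.bind h) l → ∃ l', l' <+: l ∧ IsRightComb t l' := by
  induction t with
  | leaf a => exact fun _ => ⟨[], List.nil_prefix, leaf a⟩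
  | node x t ih =>
    intro l hl
    cases hl with
    | node _ _ l hlf hl =>
      obtain ⟨l', hl', ht⟩ := ih _ hl
      refine ⟨x :: l', (List.prefix_cons_inj x).2 hl', node x t l' (fun j hj => ?_) ht⟩
      obtain ⟨a, ha⟩ := hlf j hj
      -- Substitution never removes a vertex, so a tree that becomes a leaf was one.
      cases htj : t j with
      | leaf b => exact ⟨b, rfl⟩
      | node y t' => simp [htj, OpTree.bind] at ha

theorem map {t : OpTree X d L} {l : List X} (h : IsRightComb t l) (u : L → M) :
    IsRightComb (t.map u) l := by
  induction h with
  | leaf a => exact leaf _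
  | node x t l h _ ih =>
    refine node x _ l (fun j hj => ?_) ih
    obtain ⟨a, ha⟩ := h j hj
    exact ⟨u a, by simp [ha, OpTree.bind]⟩

/-- Grafting a right comb onto the last leaf of a right comb. -/
theorem bind {t : OpTree X d L} {l : List X} (ht : IsRightComb t l) {h : L → OpTree X d M}
    {l' : List X} {a : L} : ∀ {p : List L}, t.leaves = p ++ [a] →
    (∀ b ∈ p, ∃ c, h b = .leaf c) → IsRightComb (h a) l' → IsRightComb (t.bind h) (l ++ l') := by
  induction ht with
  | leaf b =>
    intro p hp _ ha
    have : b = a := by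
      rcases p with _ | ⟨c, p⟩ <;> simp [leaves] at hp
      exact hp
    subst this
    exact ha
  | node x t l hlf _ ih =>
    intro p hp hb ha
    have e : (OpTree.node x t).leaves = (List.ofFn fun j : Fin (d x) =>
        (t j.castSucc).leaves).flatten ++ (t (Fin.last _)).leaves := leaves_node_eq_append x t
    obtain ⟨q, c, hq⟩ : ∃ q c, (t (Fin.last _)).leaves = q ++ [c] :=
      ⟨_, _, (List.dropLast_append_getLast (leaves_ne_nil _)).symm⟩
    rw [hq, ← List.append_assoc, hp] at e
    obtain ⟨rfl, e2⟩ := List.append_inj' e rfl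
    obtain rfl : a = c := by simpa using e2
    refine node x _ _ (fun j hj => ?_) (ih hq (fun b hbq => hb b (by simp [hbq])) ha)
    obtain ⟨b, hbj⟩ := hlf j hj
    obtain ⟨j', rfl⟩ := Fin.exists_castSucc_eq.2 hj
    obtain ⟨z, hz⟩ := hb b (List.mem_append_left _
      (List.mem_flatten.2 ⟨_, List.mem_ofFn.2 ⟨j', rfl⟩, by simp [hbj, leaves]⟩))
    exact ⟨z, by simp [hbj, OpTree.bind, hz]⟩

/-- At a vertex all inputs but the last are single leaves, so the order of the minimal leaves is
already the order of all leaves. -/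
theorem pairwise_leaves [LT L] {t : OpTree X d L} {l : List X} (h : IsRightComb t l)
    (hc : t.IsCanonical) : t.leaves.Pairwise (· < ·) := by
  induction h with
  | leaf a => simp [leaves]
  | node x t l h _ ih =>
    rw [leaves, List.pairwise_flatten, List.pairwise_ofFn]
    refine ⟨fun m hm => ?_, fun j j' hj => ?_⟩
    · obtain ⟨j, rfl⟩ := List.mem_ofFn.1 hm
      by_cases hj : j = Fin.last _
      · exact hj ▸ ih (hc.2 _)
      · obtain ⟨a, ha⟩ := h j hj
        simp [ha, leaves]
    · obtain ⟨a, ha⟩ := h j (hj.trans_le (Fin.le_last _)).ne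
      have := hc.1 j j' hj
      simpa [Precedes, ha, leaves] using this

/-- A right comb can be cut below any of its vertices. -/
theorem exists_join {l₁ : List X} : ∀ {t : OpTree X d L} {l₂ : List X},
    IsRightComb t (l₁ ++ l₂) →
    ∃ T : OpTree X d (OpTree X d L), T.bind id = t ∧ IsRightComb T l₁ := by
  induction l₁ with
  | nil => exact fun {t} _ _ => ⟨.leaf t, rfl, leaf t⟩
  | cons x l ih =>
    intro t l₂ ht
    cases ht with
    | node _ t _ h hl =>
      obtain ⟨T, hT, hTl⟩ := ih hl
      refine ⟨.node x fun j => if j = Fin.last _ then T else .leaf (t j), ?_, ?_⟩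
      · simp only [OpTree.bind]
        congr 1
        funext j
        split_ifs with hj
        · rw [hT, hj]
        · rfl
      · refine node x _ _ (fun j hj => ⟨t j, by simp [hj]⟩) (by simpa using hTl)

theorem exists_isBranch_of_suffix {t : OpTree X d L} {l : List X} (h : IsRightComb t l) :
    ∀ {l' : List X}, l' <:+ l → ∃ u, IsBranch u t ∧ IsRightComb u l' := by
  induction h with
  | leaf a =>
    intro l' hl'
    rw [List.suffix_nil] at hl'
    exact ⟨_, .refl _, hl' ▸ leaf a⟩
  | node x t l h hl ih =>
    intro l' hl'
    rcases List.suffix_cons_iff.1 hl' with rfl | hl'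
    · exact ⟨_, .refl _, node x t l h hl⟩
    · obtain ⟨u, hu, hul⟩ := ih hl'
      exact ⟨u, .child _ _ _ _ hu, hul⟩

end IsRightComb

/-- Trees with unary vertices are right combs. -/
theorem isRightComb_letters (t : OpTree X (fun _ => 0) L) : IsRightComb t t.letters := by
  induction t with
  | leaf a => exact .leaf a
  | node x t ih =>
    have : (@OpTree.node X (fun _ => 0) L x t).letters = x :: (t 0).letters := by simp [letters]
    rw [this]
    exact @IsRightComb.node X (fun _ => 0) L x t _ (fun j hj => absurd (Fin.eq_zero j) hj) (ih 0)

end OpTree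

/-! ### Lexicographic comparison of concatenations -/

namespace List

variable {E E' : Type*} [LinearOrder E] [LinearOrder E']

theorem append_lt_append_of_lt {P Q : List E} (h : P < Q) (hl : P.length = Q.length)
    (R S : List E) : P ++ R < Q ++ S := by
  induction P generalizing Q with
  | nil => cases Q with
    | nil => exact absurd h (lt_irrefl _)
    | cons q Q => simp at hl
  | cons p P ih => cases Q with
    | nil => simp at hl
    | cons q Q =>
      rw [cons_append, cons_append, cons_lt_cons_iff]
      rcases cons_lt_cons_iff.1 h with h | ⟨rfl, h'⟩
      · exact Or.inl h
      · exact Or.inr ⟨rfl, ih h' (by simpa using hl)⟩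

theorem append_lt_append_iff_right (P : List E) {R S : List E} : P ++ R < P ++ S ↔ R < S := by
  induction P with
  | nil => rfl
  | cons p P ih => simp [ih]

theorem append_lt_append_of_le_of_lt {P Q R S : List E} (h : P ≤ Q) (hl : P.length = Q.length)
    (h' : R < S) : P ++ R < Q ++ S := by
  rcases h.eq_or_lt with rfl | h
  · exact (append_lt_append_iff_right P).2 h'
  · exact append_lt_append_of_lt h hl R S

theorem append_le_append_of_le_of_le {P Q R S : List E} (h : P ≤ Q) (hl : P.length = Q.length)
    (h' : R ≤ S) : P ++ R ≤ Q ++ S := by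
  rcases h'.eq_or_lt with rfl | h'
  · rcases h.eq_or_lt with rfl | h
    · exact le_rfl
    · exact (append_lt_append_of_lt h hl R R).le
  · exact (append_lt_append_of_le_of_lt h hl h').le

theorem singleton_le_singleton {a b : E} (h : a ≤ b) : [a] ≤ [b] := by
  rcases h.eq_or_lt with rfl | h
  · exact le_rfl
  · exact (cons_lt_cons_iff.2 (Or.inl h)).le

theorem flatMap_le_flatMap_of_forall {ι : Type*} (P : List ι) {F G : ι → List E}
    (h : ∀ e, F e ≤ G e) (hl : ∀ e, (F e).length = (G e).length) : P.flatMap F ≤ P.flatMap G := by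
  induction P with
  | nil => exact le_rfl
  | cons p P ih =>
    simp only [flatMap_cons]
    exact append_le_append_of_le_of_le (h p) (hl p) ih

theorem map_le_map_of_forall {ι : Type*} (P : List ι) {f g : ι → E} (h : ∀ e, f e ≤ g e) :
    P.map f ≤ P.map g := by
  simpa only [map_eq_flatMap] using
    flatMap_le_flatMap_of_forall P (F := fun e => [f e]) (G := fun e => [g e])
      (fun e => singleton_le_singleton (h e)) fun _ => rfl

/-- The blocks `F e` may differ in length, so `hF` has to decide the comparison whatever follows
them. -/
theorem flatMap_lt_flatMap_of_lt {F : E → List E'}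
    (hF : ∀ e e', e < e' → ∀ Y Y', F e ++ Y < F e' ++ Y') {P Q : List E} (h : P < Q)
    (hl : P.length = Q.length) : P.flatMap F < Q.flatMap F := by
  induction P generalizing Q with
  | nil => cases Q with
    | nil => exact absurd h (lt_irrefl _)
    | cons q Q => simp at hl
  | cons p P ih => cases Q with
    | nil => simp at hl
    | cons q Q =>
      simp only [flatMap_cons]
      rcases cons_lt_cons_iff.1 h with h | ⟨rfl, h'⟩
      · exact hF _ _ h _ _
      · exact (append_lt_append_iff_right _).2 (ih h' (by simpa using hl))

theorem map_le_map_of_le {f : E → E'} (hf : StrictMono f) {P Q : List E} (h : P ≤ Q)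
    (hl : P.length = Q.length) : P.map f ≤ Q.map f := by
  rcases h.eq_or_lt with rfl | h
  · exact le_rfl
  · have := flatMap_lt_flatMap_of_lt (F := fun e => [f e])
      (fun e e' he Y Y' => cons_lt_cons_iff.2 (Or.inl (hf he))) h hl
    simpa only [map_eq_flatMap] using this.le

end List

/-! ### The monoid of transitions and its ordering -/

/-- The transition along a path in a tree: the number of edges that are not attached to a last
input, and the decorations of the vertices passed after the last such edge. -/
@[ext] structure Turn (X : Type*) where
  left : ℕ
  run : FreeMonoid X

namespace Turn

variable {X : Type*}

instance : One (Turn X) := ⟨⟨0, 1⟩⟩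

instance : Mul (Turn X) :=
  ⟨fun m n => if n.left = 0 then ⟨m.left, m.run * n.run⟩ else ⟨m.left + n.left, n.run⟩⟩

theorem one_def : (1 : Turn X) = ⟨0, 1⟩ := rfl

theorem mul_def (m n : Turn X) :
    m * n = if n.left = 0 then ⟨m.left, m.run * n.run⟩ else ⟨m.left + n.left, n.run⟩ := rfl

theorem left_mul (m n : Turn X) : (m * n).left = m.left + n.left := by
  rw [mul_def]
  split_ifs with h <;> simp [h]

theorem run_mul (m n : Turn X) :
    (m * n).run = if n.left = 0 then m.run * n.run else n.run := by
  rw [mul_def]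
  split_ifs <;> rfl

instance : Monoid (Turn X) where
  one_mul m := by ext <;> simp [left_mul, run_mul, one_def]
  mul_one m := by ext <;> simp [left_mul, run_mul, one_def]
  mul_assoc m n r := by
    ext1
    · simp only [left_mul, add_assoc]
    · simp only [left_mul, run_mul]
      by_cases hr : r.left = 0 <;> by_cases hn : n.left = 0 <;> simp [hr, hn, mul_assoc]

theorem mul_left_cancel' {m n r : Turn X} (h : m * n = m * r) : n = r := by
  have h1 : n.left = r.left := by simpa [left_mul] using congrArg left h
  have h2 := congrArg run h
  rw [run_mul, run_mul, h1] at h2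
  ext1
  · exact h1
  · split_ifs at h2
    · exact mul_left_cancel h2
    · exact h2

section Order

variable [LinearOrder (FreeMonoid X)]

/-- Giving `left` priority over the letters makes trees that leave the right spine large, whatever
their decorations. -/
instance : LinearOrder (Turn X) :=
  LinearOrder.lift' (fun m => toLex (m.left, m.run)) fun m n h => by
    have : (m.left, m.run) = (n.left, n.run) := toLex.injective h
    rw [Prod.mk.injEq] at this
    exact Turn.ext this.1 this.2

theorem lt_iff {m n : Turn X} :
    m < n ↔ m.left < n.left ∨ m.left = n.left ∧ m.run < n.run :=
  Prod.Lex.toLex_lt_toLex (x := (m.left, m.run)) (y := (n.left, n.run))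

theorem mul_lt_mul_left [MulLeftStrictMono (FreeMonoid X)] (m : Turn X) {n r : Turn X}
    (h : n < r) : m * n < m * r := by
  rw [lt_iff] at h ⊢
  rcases h with h | ⟨h1, h2⟩
  · exact Or.inl (by simpa [left_mul] using h)
  · refine Or.inr ⟨by simp [left_mul, h1], ?_⟩
    rw [run_mul, run_mul, h1]
    split_ifs
    · exact mul_lt_mul_right h2 _
    · exact h2

/-- If `r.left` were nonzero, `r` would erase the runs of `m` and `n`, and strictness could be lost.
-/
theorem mul_lt_mul_right' [MulRightStrictMono (FreeMonoid X)] {m n : Turn X} (h : m < n)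
    {r : Turn X} (hr : r.left = 0) : m * r < n * r := by
  rw [lt_iff] at h ⊢
  rcases h with h | ⟨h1, h2⟩
  · exact Or.inl (by simpa [left_mul] using h)
  · refine Or.inr ⟨by simp [left_mul, h1], ?_⟩
    rw [run_mul, run_mul, if_pos hr, if_pos hr]
    exact _root_.mul_lt_mul_left h2 _

theorem mul_le_mul_right' [MulRightStrictMono (FreeMonoid X)] {m n : Turn X} (h : m ≤ n)
    (r : Turn X) : m * r ≤ n * r := by
  rcases h.eq_or_lt with rfl | h
  · exact le_rfl
  · by_cases hr : r.left = 0
    · exact (mul_lt_mul_right' h hr).le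
    · rcases lt_iff.1 h with h | ⟨h1, h2⟩
      · exact (lt_iff.2 (Or.inl (by simpa [left_mul] using h))).le
      -- Here `m` and `n` differ only in their runs, which `r` erases, so the products coincide.
      · exact (Turn.ext (by simp [left_mul, h1]) (by simp [run_mul, hr])).le

end Order

end Turn

/-! ### The key of a tree and its injectivity -/

namespace OpTree

variable {X : Type*} {d : X → ℕ} {L M : Type*}

/-- The transition along the edge below the input `j` of a vertex decorated by `x`. -/
def step (x : X) (j : Fin (d x + 1)) : Turn X :=
  if j = Fin.last (d x) then ⟨0, FreeMonoid.of x⟩ else ⟨1, 1⟩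

/-- The leaves from left to right, together with the transitions from the root to them. -/
def key : OpTree X d L → List (L × Turn X)
  | leaf a => [(a, 1)]
  | node x t => (List.ofFn fun j => (t j).key.map fun e => (e.1, step x j * e.2)).flatten

theorem map_fst_key (t : OpTree X d L) : t.key.map Prod.fst = t.leaves := by
  induction t with
  | leaf a => rfl
  | node x t ih =>
    simp only [key, leaves, List.map_flatten, List.map_ofFn, ← ih]
    congr 2
    funext j
    simp

theorem length_key (t : OpTree X d L) : t.key.length = t.leaves.length := by
  rw [← map_fst_key, List.length_map]

theorem key_bind (t : OpTree X d L) (h : L → OpTree X d M) :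
    (t.bind h).key = t.key.flatMap fun e => (h e.1).key.map fun e' => (e'.1, e.2 * e'.2) := by
  induction t with
  | leaf a => simp [bind, key]
  | node x t ih =>
    simp only [bind, key, ih, List.flatMap_def, List.map_flatten, List.map_ofFn,
      List.flatten_flatten]
    congr 2
    funext j
    simp [Function.comp_def, mul_assoc]

theorem key_node_eq_append (x : X) (t : Fin (d x + 1) → OpTree X d L) :
    (node x t).key =
      (List.ofFn fun j : Fin (d x) =>
        (t j.castSucc).key.map fun e => (e.1, ⟨1, 1⟩ * e.2)).flatten ++
      (t (Fin.last _)).key.map fun e => (e.1, ⟨0, FreeMonoid.of x⟩ * e.2) := by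
  rw [key, List.ofFn_succ', List.concat_eq_append, List.flatten_append]
  simp [step, (Fin.castSucc_lt_last _).ne]

/-- The last leaf is the only one that is reached from the root through last inputs. -/
theorem exists_key_eq_concat (t : OpTree X d L) :
    ∃ P a w, t.key = P ++ [(a, ⟨0, w⟩)] ∧ ∀ e ∈ P, e.2.left ≠ 0 := by
  induction t with
  | leaf a => exact ⟨[], a, 1, rfl, by simp⟩
  | node x t ih =>
    obtain ⟨P, a, w, h, hP⟩ := ih (Fin.last _)
    refine ⟨_, a, FreeMonoid.of x * w, by
      rw [key_node_eq_append, h, List.map_append, ← List.append_assoc]; rfl, ?_⟩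
    intro e he
    rcases List.mem_append.1 he with he | he
    · obtain ⟨l, hl, hel⟩ := List.mem_flatten.1 he
      obtain ⟨j, rfl⟩ := List.mem_ofFn.1 hl
      obtain ⟨e', _, rfl⟩ := List.mem_map.1 hel
      simp [Turn.left_mul]
    · obtain ⟨e', he', rfl⟩ := List.mem_map.1 he
      simpa [Turn.left_mul] using hP e' he'

theorem _root_.List.eq_of_concat_append_eq {E : Type*} {p : E → Prop} {P P' R R' : List E}
    {e e' : E} (hP : ∀ a ∈ P, ¬ p a) (he : p e) (hP' : ∀ a ∈ P', ¬ p a) (he' : p e')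
    (h : P ++ e :: R = P' ++ e' :: R') : P = P' ∧ e = e' := by
  induction P generalizing P' with
  | nil => cases P' with
    | nil => simpa using (List.cons.inj h).1
    | cons q Q => exact absurd ((List.cons.inj h).1 ▸ he) (hP' q (by simp))
  | cons q Q ih => cases P' with
    | nil => exact absurd ((List.cons.inj h).1 ▸ he') (hP q (by simp))
    | cons q' Q' =>
      obtain ⟨rfl, h1⟩ := List.cons.inj h
      obtain ⟨rfl, h2⟩ := ih (fun a ha => hP a (List.mem_cons_of_mem _ ha))
        (fun a ha => hP' a (List.mem_cons_of_mem _ ha)) h1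
      exact ⟨rfl, h2⟩

/-- Keys are self-delimiting: the last leaf is the only one with `left = 0`, so after multiplication
by `m` the first entry with `left = m.left` marks the end of the block. -/
theorem key_eq_of_map_append_eq {t t' : OpTree X d L} (m : Turn X) {R R' : List (L × Turn X)}
    (h : (t.key.map fun e => (e.1, m * e.2)) ++ R = (t'.key.map fun e => (e.1, m * e.2)) ++ R') :
    t.key = t'.key := by
  obtain ⟨P, a, w, hk, hP⟩ := t.exists_key_eq_concat
  obtain ⟨P', a', w', hk', hP'⟩ := t'.exists_key_eq_concat
  have hinj : Function.Injective fun e : L × Turn X => (e.1, m * e.2) := fun e e' he => by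
    simp only [Prod.mk.injEq] at he
    exact Prod.ext he.1 (Turn.mul_left_cancel' he.2)
  simp only [hk, hk', List.map_append, List.append_assoc, List.map_cons, List.map_nil,
    List.cons_append, List.nil_append] at h
  have hneg : ∀ {Q : List (L × Turn X)}, (∀ e ∈ Q, e.2.left ≠ 0) →
      ∀ e ∈ Q.map fun e => (e.1, m * e.2), ¬ e.2.left = m.left := by
    intro Q hQ e he
    obtain ⟨e', he', rfl⟩ := List.mem_map.1 he
    simpa [Turn.left_mul] using hQ e' he'
  obtain ⟨h1, h2⟩ := List.eq_of_concat_append_eq (p := fun e : L × Turn X => e.2.left = m.left)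
    (hneg hP) (by simp [Turn.left_mul]) (hneg hP') (by simp [Turn.left_mul]) h
  rw [hk, hk', List.map_injective_iff.2 hinj h1]
  exact congrArg (fun e => P' ++ [e]) (hinj h2)

theorem _root_.List.eq_of_flatten_ofFn_eq {E : Type*} {n : ℕ} {F G : Fin n → List E}
    (hp : ∀ j R R', F j ++ R = G j ++ R' → F j = G j)
    (h : (List.ofFn F).flatten = (List.ofFn G).flatten) (j : Fin n) : F j = G j := by
  induction n with
  | zero => exact j.elim0
  | succ n ih =>
    simp only [List.ofFn_succ, List.flatten_cons] at h
    have h0 := hp _ _ _ h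
    rw [h0, List.append_cancel_left_eq] at h
    refine Fin.cases h0 (fun j => ?_) j
    exact ih (fun j => hp j.succ) h j

/-- The run at the last leaf starts with the decoration of the root, or is empty for a bare leaf.
Once the root is known, the self-delimiting blocks of its inputs can be read off one after another.
-/
theorem key_injective : Function.Injective (key : OpTree X d L → List (L × Turn X)) := by
  intro t
  induction t with
  | leaf a =>
    intro t' h
    cases t' with
    | leaf b => simpa [key] using h
    | node x t =>
      obtain ⟨P, b, w, hk, -⟩ := (t (Fin.last _)).exists_key_eq_concat
      rw [key_node_eq_append, hk, List.map_append, ← List.append_assoc] at h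
      have h' := (List.append_inj' (s₁ := []) h rfl).2
      simp [Turn.mul_def, Turn.one_def] at h'
      exact absurd (congrArg FreeMonoid.length h'.2) (by simp; omega)
  | node x t ih =>
    intro t' h
    cases t' with
    | leaf b =>
      obtain ⟨P, b, w, hk, -⟩ := (t (Fin.last _)).exists_key_eq_concat
      rw [key_node_eq_append, hk, List.map_append, ← List.append_assoc] at h
      have h' := (List.append_inj' (s₂ := []) h rfl).2
      simp [Turn.mul_def, Turn.one_def] at h'
    | node x' t' =>
      have hx : x = x' := by
        obtain ⟨P, b, w, hk, -⟩ := (t (Fin.last _)).exists_key_eq_concat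
        obtain ⟨P', b', w', hk', -⟩ := (t' (Fin.last _)).exists_key_eq_concat
        rw [key_node_eq_append, key_node_eq_append, hk, hk', List.map_append, List.map_append,
          ← List.append_assoc, ← List.append_assoc] at h
        have h' := (List.append_inj' h rfl).2
        simp [Turn.mul_def] at h'
        have := congrArg FreeMonoid.toList h'.2
        simp at this
        exact this.1
      subst hx
      congr 1
      funext j
      have hj := List.eq_of_flatten_ofFn_eq
        (fun j R R' hR => by rw [key_eq_of_map_append_eq _ hR]) h j
      exact ih j (key_eq_of_map_append_eq (step x j) (R := []) (R' := []) (by simpa using hj))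

/-- A leaf off the end of the spine is reached by one final non-last edge, which erases all letters;
only the last leaf sees the word. -/
theorem IsRightComb.exists_key_eq {t : OpTree X d L} {l : List X} (h : IsRightComb t l) :
    ∃ p a, t.leaves = p ++ [a] ∧
      t.key = (p.map fun b => (b, ⟨1, 1⟩)) ++ [(a, ⟨0, FreeMonoid.ofList l⟩)] := by
  induction h with
  | leaf a => exact ⟨[], a, rfl, rfl⟩
  | node x t l h _ ih =>
    obtain ⟨p, a, h1, h2⟩ := ih
    refine ⟨(List.ofFn fun j : Fin (d x) => (t j.castSucc).leaves).flatten ++ p, a, ?_, ?_⟩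
    · rw [leaves_node_eq_append, h1, List.append_assoc]
    · rw [key_node_eq_append, h2, List.map_append, List.map_append, List.append_assoc,
        List.map_flatten, List.map_ofFn]
      congr 1
      · congr 2
        funext j
        obtain ⟨b, hb⟩ := h j.castSucc (Fin.castSucc_lt_last j).ne
        simp [hb, key, leaves]
      · simp [Turn.mul_def, FreeMonoid.ofList_cons]

end OpTree

/-! ### Right combs as tree monomials -/

namespace TreeMonomial

variable {X : Type*} {d : X → ℕ}

theorem length_leaves {n : ℕ} (α : TreeMonomial X d n) : α.tree.leaves.length = n + 1 := by
  rw [← List.toFinset_card_of_nodup α.nodup]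
  have : α.tree.leaves.toFinset = Finset.univ := by
    ext a
    simp [α.mem_leaves a]
  rw [this, Finset.card_univ, Fintype.card_fin]

theorem arity_eq {n : ℕ} {α : TreeMonomial X d n} {l : List X} (h : α.tree.IsRightComb l) :
    n = (l.map d).sum := by
  have := α.tree.length_leaves
  rw [α.length_leaves, h.letters_eq] at this
  omega

/-- Increasing leaves that exhaust all labels leave no freedom in the labelling. -/
theorem leaves_eq_finRange {n : ℕ} {α : TreeMonomial X d n} {l : List X}
    (h : α.tree.IsRightComb l) : α.tree.leaves = List.finRange (n + 1) := by
  refine List.Perm.eq_of_pairwise (le := (· < ·)) (fun a b _ _ h h' => absurd h h'.asymm)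
    (h.pairwise_leaves α.canonical) (List.pairwise_lt_finRange _) ?_
  rw [List.perm_ext_iff_of_nodup α.nodup (List.nodup_finRange _)]
  simp [α.mem_leaves]

theorem leaves_eq_append {n : ℕ} {α : TreeMonomial X d n} {l : List X}
    (h : α.tree.IsRightComb l) :
    α.tree.leaves = (List.finRange n).map Fin.castSucc ++ [Fin.last n] := by
  rw [leaves_eq_finRange h, List.finRange_succ_last]

theorem key_eq_of_isRightComb {n : ℕ} {α : TreeMonomial X d n} {l : List X}
    (h : α.tree.IsRightComb l) :
    α.tree.key = ((List.finRange n).map fun j => (j.castSucc, ⟨1, 1⟩)) ++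
      [(Fin.last n, ⟨0, FreeMonoid.ofList l⟩)] := by
  obtain ⟨p, a, h1, h2⟩ := h.exists_key_eq
  obtain ⟨rfl, h4⟩ := List.append_inj' (h1.symm.trans (leaves_eq_append h)) rfl
  obtain rfl : a = Fin.last n := by simpa using h4
  rw [h2, List.map_map]
  rfl

/-- A right comb is determined by its decorations. -/
theorem eq_of_isRightComb {n : ℕ} {α β : TreeMonomial X d n} {l : List X}
    (hα : α.tree.IsRightComb l) (hβ : β.tree.IsRightComb l) : α = β := by
  ext1
  exact OpTree.key_injective ((key_eq_of_isRightComb hα).trans (key_eq_of_isRightComb hβ).symm)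

theorem isRightComb_comp {a b c : ℕ} {s : Shuffle a b c} (hs : s.i = Fin.last a)
    {α : TreeMonomial X d a} {β : TreeMonomial X d b} {l l' : List X}
    (hα : α.tree.IsRightComb l) (hβ : β.tree.IsRightComb l') :
    (α.comp s β).tree.IsRightComb (l ++ l') := by
  refine hα.bind (leaves_eq_append hα) (fun j hj => ?_) ?_
  · obtain ⟨j, _, rfl⟩ := List.mem_map.1 hj
    exact ⟨_, if_neg (hs ▸ (Fin.castSucc_lt_last j).ne)⟩
  · rw [graft, if_pos hs.symm]
    exact hβ.map _

theorem isRightComb_unit : (unit : TreeMonomial X d 0).tree.IsRightComb [] := .leaf 0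

theorem isRightComb_corolla (x : X) : (corolla x : TreeMonomial X d (d x)).tree.IsRightComb [x] :=
  .node x _ [] (fun j _ => ⟨j, rfl⟩) (.leaf _)

end TreeMonomial

theorem List.finRange_add_succ (p r : ℕ) : List.finRange (p + (r + 1)) =
    (List.finRange p).map (Fin.castAdd (r + 1)) ++
      Fin.natAdd p 0 :: (List.finRange r).map fun j => Fin.natAdd p j.succ := by
  rw [← List.ofFn_id, List.ofFn_add, List.ofFn_succ, List.ofFn_eq_map, List.ofFn_eq_map]
  rfl

theorem fin_val_le_orderEmbedding {n m : ℕ} (f : Fin n ↪o Fin m) (j : Fin n) :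
    (j : ℕ) ≤ f j := by
  obtain ⟨j, hj⟩ := j
  induction j with
  | zero => exact Nat.zero_le _
  | succ j ih =>
    have : f ⟨j, by omega⟩ < f ⟨j + 1, hj⟩ := f.strictMono (Nat.lt_succ_self j)
    exact (ih (by omega)).trans_lt this

/-- The shuffle composition at the last input. -/
def Shuffle.last (a b : ℕ) : Shuffle a b (a + b) where
  i := Fin.last a
  f := Fin.castLEOrderEmb (by omega)
  g := OrderEmbedding.ofStrictMono (fun l => ⟨a + l, by omega⟩) fun _ _ h => by
    rw [Fin.mk_lt_mk]
    exact Nat.add_lt_add_left h a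
  glue := rfl
  disj j l h := by
    have h' : (j : ℕ) = a + l := congrArg Fin.val h
    ext
    rw [Fin.val_last]
    omega
  cover z := by
    by_cases h : (z : ℕ) ≤ a
    · exact Or.inl ⟨⟨z, by omega⟩, by ext; simp⟩
    · exact Or.inr ⟨⟨z - a, by omega⟩, Fin.ext (Nat.add_sub_of_le (not_le.1 h).le)⟩

theorem Shuffle.last_i (a b : ℕ) : (Shuffle.last a b).i = Fin.last a := rfl

namespace TreeMonomial

variable {X : Type*} {d : X → ℕ}

theorem exists_isRightComb {n : ℕ} (l : List X) (hn : n = (l.map d).sum) :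
    ∃ α : TreeMonomial X d n, α.tree.IsRightComb l := by
  induction l generalizing n with
  | nil =>
    obtain rfl : n = 0 := by simpa using hn
    exact ⟨unit, isRightComb_unit⟩
  | cons x l ih =>
    obtain ⟨α, hα⟩ := ih rfl
    obtain rfl : n = d x + (l.map d).sum := by simpa using hn
    exact ⟨_, isRightComb_comp (Shuffle.last_i _ _) (isRightComb_corolla x) hα⟩

/-! ### The admissible ordering of tree monomials -/

section Order

/-- The leaves from left to right with the transitions leading to them, for lexicographic
comparison. -/
def lexKey {n : ℕ} (α : TreeMonomial X d n) : List (Fin (n + 1) ×ₗ Turn X) :=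
  α.tree.key.map toLex

theorem lexKey_injective {n : ℕ} :
    Function.Injective (lexKey : TreeMonomial X d n → List (Fin (n + 1) ×ₗ Turn X)) := by
  intro α β h
  ext1
  exact OpTree.key_injective (List.map_injective_iff.2 toLex.injective h)

theorem length_lexKey {n : ℕ} (α : TreeMonomial X d n) : α.lexKey.length = n + 1 := by
  rw [lexKey, List.length_map, OpTree.length_key, length_leaves]

theorem exists_lexKey_eq_cons {n : ℕ} (α : TreeMonomial X d n) :
    ∃ m R, α.lexKey = toLex (0, m) :: R := by
  obtain ⟨a, l, hl, hmin⟩ := α.canonical.exists_leaves_eq_cons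
  obtain rfl : a = 0 := Fin.le_zero_iff.1 (hmin 0 (α.mem_leaves 0))
  rw [← OpTree.map_fst_key] at hl
  obtain ⟨⟨b, m⟩, R, h1, rfl, -⟩ := List.map_eq_cons_iff.1 hl
  exact ⟨m, R.map toLex, by rw [lexKey, h1]; rfl⟩

/-- The contribution to the key of a composition of an entry of the key of the first tree. -/
def keyBlock {a b c : ℕ} (s : Shuffle a b c) (β : TreeMonomial X d b)
    (e : Fin (a + 1) ×ₗ Turn X) : List (Fin (c + 1) ×ₗ Turn X) :=
  if (ofLex e).1 = s.i then
    β.lexKey.map fun e' => toLex (s.g (ofLex e').1, (ofLex e).2 * (ofLex e').2)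
  else [toLex (s.f (ofLex e).1, (ofLex e).2)]

theorem lexKey_comp {a b c : ℕ} (s : Shuffle a b c) (α : TreeMonomial X d a)
    (β : TreeMonomial X d b) : (α.comp s β).lexKey = α.lexKey.flatMap (keyBlock s β) := by
  simp only [lexKey, comp, OpTree.key_bind, List.map_flatMap, List.flatMap_map]
  congr 1
  funext e
  by_cases h : e.1 = s.i
  · rw [keyBlock, graft, if_pos h, if_pos (show (ofLex (toLex e)).1 = s.i from h)]
    simp [OpTree.map, OpTree.key_bind, OpTree.key, lexKey, ← List.map_eq_flatMap,
      Function.comp_def]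
  · rw [keyBlock, graft, if_neg h, if_neg (show ¬ (ofLex (toLex e)).1 = s.i from h)]
    simp [OpTree.key]

/-- The leftmost leaf of `β` is its minimal one, and by `glue` it inherits the label of the input
`s.i`. So the first label of a block is uniform in both cases. -/
theorem exists_keyBlock_eq_cons {a b c : ℕ} (s : Shuffle a b c) (β : TreeMonomial X d b)
    (e : Fin (a + 1) ×ₗ Turn X) : ∃ m R, keyBlock s β e = toLex (s.f (ofLex e).1, m) :: R := by
  unfold keyBlock
  split_ifs with h
  · obtain ⟨m, R, hβ⟩ := β.exists_lexKey_eq_cons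
    exact ⟨(ofLex e).2 * m, _, by rw [hβ, List.map_cons, h, s.glue]; rfl⟩
  · exact ⟨_, _, rfl⟩

variable [LinearOrder (FreeMonoid X)]

instance {n : ℕ} : LinearOrder (TreeMonomial X d n) := LinearOrder.lift' lexKey lexKey_injective

theorem le_iff {n : ℕ} {α β : TreeMonomial X d n} : α ≤ β ↔ α.lexKey ≤ β.lexKey := Iff.rfl

theorem lt_iff {n : ℕ} {α β : TreeMonomial X d n} : α < β ↔ α.lexKey < β.lexKey := Iff.rfl

/-- Only the block at `s.i` depends on `β`, and there both the relabelling `s.g` and the left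
multiplication of transitions are strictly increasing. -/
theorem comp_le_comp_left [MulLeftStrictMono (FreeMonoid X)] {a b c : ℕ} (s : Shuffle a b c)
    (α : TreeMonomial X d a) {β β' : TreeMonomial X d b} (h : β ≤ β') :
    α.comp s β ≤ α.comp s β' := by
  rw [le_iff, lexKey_comp, lexKey_comp]
  refine List.flatMap_le_flatMap_of_forall _ (fun e => ?_) fun e => ?_
  · unfold keyBlock
    split_ifs
    · refine List.map_le_map_of_le (fun p q hpq => ?_) h (by simp only [length_lexKey])
      rw [Prod.Lex.toLex_lt_toLex]
      rcases Prod.Lex.lt_iff.1 hpq with h | ⟨h1, h2⟩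
      · exact Or.inl (s.g.strictMono h)
      · exact Or.inr ⟨congrArg s.g h1, Turn.mul_lt_mul_left _ h2⟩
    · exact le_rfl
  · unfold keyBlock
    split_ifs <;> simp [length_lexKey]

/-- The first differing entries of the two keys decide. If their labels differ, so do the first
labels of their blocks; if only the transitions differ, the blocks have equal length and are
compared entry by entry. -/
theorem comp_le_comp_right [MulRightStrictMono (FreeMonoid X)] {a b c : ℕ} (s : Shuffle a b c)
    {α α' : TreeMonomial X d a} (h : α ≤ α') (β : TreeMonomial X d b) :
    α.comp s β ≤ α'.comp s β := by
  rcases h.eq_or_lt with rfl | h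
  · exact le_rfl
  rw [le_iff, lexKey_comp, lexKey_comp]
  refine (List.flatMap_lt_flatMap_of_lt (fun e e' he Y Y' => ?_) h
    (by simp only [length_lexKey])).le
  rcases Prod.Lex.lt_iff.1 he with h1 | ⟨h1, h2⟩
  · obtain ⟨m, R, hm⟩ := exists_keyBlock_eq_cons s β e
    obtain ⟨m', R', hm'⟩ := exists_keyBlock_eq_cons s β e'
    rw [hm, hm', List.cons_append, List.cons_append, List.cons_lt_cons_iff]
    exact Or.inl (Prod.Lex.toLex_lt_toLex.2 (Or.inl (s.f.strictMono h1)))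
  · have key : keyBlock s β e < keyBlock s β e' := by
      unfold keyBlock
      rw [← h1]
      split_ifs with hi
      · obtain ⟨P, z, w, hP, -⟩ := β.tree.exists_key_eq_concat
        simp only [lexKey, hP, List.map_append, List.map_map]
        refine List.append_lt_append_of_le_of_lt (List.map_le_map_of_forall _ fun p => ?_)
          (by simp) (List.cons_lt_cons_iff.2 (Or.inl ?_))
        · rw [Prod.Lex.le_iff]
          exact Or.inr ⟨rfl, Turn.mul_le_mul_right' h2.le _⟩
        · rw [Prod.Lex.lt_iff]
          exact Or.inr ⟨rfl, Turn.mul_lt_mul_right' h2 rfl⟩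
      · exact List.cons_lt_cons_iff.2 (Or.inl (Prod.Lex.lt_iff.2 (Or.inr ⟨rfl, h2⟩)))
    refine List.append_lt_append_of_lt key ?_ _ _
    unfold keyBlock
    rw [← h1]
    split_ifs <;> simp

/-- Tree monomials are compared first by their arities. -/
@[reducible] def sigmaOrder (X : Type*) [LinearOrder (FreeMonoid X)] (d : X → ℕ) :
    LinearOrder (Σ n, TreeMonomial X d n) :=
  (inferInstance : LinearOrder (Σₗ n, TreeMonomial X d n))

theorem sigmaOrder_le_iff {n : ℕ} {α β : TreeMonomial X d n} :
    (sigmaOrder X d).le ⟨n, α⟩ ⟨n, β⟩ ↔ α ≤ β :=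
  (Sigma.lex_iff (a := ⟨n, α⟩) (b := ⟨n, β⟩)).trans (by simp)

theorem sigmaOrder_lt_iff {n : ℕ} {α β : TreeMonomial X d n} :
    (sigmaOrder X d).lt ⟨n, α⟩ ⟨n, β⟩ ↔ α < β :=
  (Sigma.lex_iff (a := ⟨n, α⟩) (b := ⟨n, β⟩)).trans (by simp)

theorem isAdmissible_sigmaOrder [MulLeftStrictMono (FreeMonoid X)]
    [MulRightStrictMono (FreeMonoid X)] : IsAdmissible (sigmaOrder X d) where
  lt_of_arity_lt α β h := Sigma.Lex.left _ _ h
  comp_le_comp s α α' β β' h h' := by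
    rw [sigmaOrder_le_iff] at h h' ⊢
    exact (comp_le_comp_left s α h').trans (comp_le_comp_right s h β')

/-- Combs of equal arity have equal keys up to the last entry, which holds the word. -/
theorem lt_of_isRightComb {n : ℕ} {α β : TreeMonomial X d n} {l l' : List X}
    (hα : α.tree.IsRightComb l) (hβ : β.tree.IsRightComb l')
    (h : FreeMonoid.ofList l < FreeMonoid.ofList l') : α < β := by
  rw [lt_iff, lexKey, lexKey, key_eq_of_isRightComb hα, key_eq_of_isRightComb hβ,
    List.map_append, List.map_append, List.append_lt_append_iff_right]
  exact List.cons_lt_cons_iff.2 (Or.inl (Prod.Lex.lt_iff.2 (Or.inr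
    ⟨rfl, Turn.lt_iff.2 (Or.inr ⟨rfl, h⟩)⟩)))

/-- Among the compositions of two right combs, the right comb is the smallest one. -/
theorem le_comp_of_isRightComb (hd : ∀ x, 0 < d x) {a b c : ℕ} (s : Shuffle a b c)
    {α : TreeMonomial X d a} {β : TreeMonomial X d b} {γ : TreeMonomial X d c} {l l' : List X}
    (hα : α.tree.IsRightComb l) (hβ : β.tree.IsRightComb l')
    (hγ : γ.tree.IsRightComb (l ++ l')) : γ ≤ α.comp s β := by
  by_cases hs : s.i = Fin.last a
  · exact (eq_of_isRightComb hγ (isRightComb_comp hs hα hβ)).le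
  have hc := s.degree_eq
  -- A degenerate `β` contributes no extra turn; the composition is then `α` itself and equality
  -- holds.
  cases hβ' : β.tree with
  | leaf z =>
    rw [hβ'] at hβ
    cases hβ
    obtain rfl : b = 0 := by simpa [hβ', OpTree.leaves] using β.length_leaves.symm
    obtain rfl : a = c := hc
    obtain rfl : β = unit := by
      ext1
      rw [hβ', Fin.eq_zero z]
      rfl
    rw [comp_unit, List.append_nil] at *
    exact (eq_of_isRightComb hγ hα).le
  | node x t =>
    obtain ⟨i, hi⟩ := Fin.exists_castSucc_eq.2 hs
    -- Positivity of the degrees ensures that the first leaf of `β` is not its last one, so that its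
    -- transition is `⟨1, 1⟩`.
    have hb : 0 < b := by
      rw [hβ'] at hβ
      cases hβ with
      | node _ _ l h hl =>
        have := arity_eq (hβ' ▸ OpTree.IsRightComb.node x t l h hl)
        have := hd x
        simp at *
        omega
    obtain ⟨b, rfl⟩ : ∃ b', b = b' + 1 := ⟨b - 1, by omega⟩
    -- The grafting position is `p`, followed by `r` further non-last leaves of `α`. Both keys are
    -- split at the entry `p`.
    obtain ⟨p, r, rfl, rfl⟩ : ∃ p r, ∃ h : a = p + (r + 1), i = Fin.cast h.symm (Fin.natAdd p 0) :=
      ⟨i, a - i - 1, by omega, by ext; simp⟩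
    obtain rfl : c = p + (r + b + 1 + 1) := by omega
    refine le_of_lt ?_
    rw [lt_iff, lexKey_comp, lexKey, lexKey, key_eq_of_isRightComb hα, key_eq_of_isRightComb hγ,
      List.finRange_add_succ p r, List.finRange_add_succ p (r + b + 1)]
    simp only [List.map_append, List.map_cons, List.flatMap_append, List.flatMap_cons,
      List.map_map, List.append_assoc, List.cons_append, List.flatMap_map]
    have hne : ∀ j : Fin p, keyBlock s β (toLex ((Fin.castAdd (r + 1) j).castSucc, ⟨1, 1⟩)) =
        [toLex (s.f (Fin.castAdd (r + 1) j).castSucc, ⟨1, 1⟩)] := fun j =>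
      if_neg fun h => by
        have := congrArg Fin.val (h.trans hi.symm)
        simp at this
        omega
    rw [List.map_eq_flatMap]
    -- Before position `p` the transitions agree and an increasing map only raises labels; at `p`
    -- the transition `⟨1, 1⟩` of the comb meets `⟨2, 1⟩`.
    refine List.append_lt_append_of_le_of_lt
      (List.flatMap_le_flatMap_of_forall _ (fun j => ?_) fun j => ?_) ?_ ?_
    · rw [Function.comp_apply, Function.comp_apply, Function.comp_apply, Function.comp_apply, hne]
      exact List.singleton_le_singleton (Prod.Lex.toLex_mono
        ⟨Fin.le_def.2 (fin_val_le_orderEmbedding s.f (Fin.castAdd (r + 1) j).castSucc), le_rfl⟩)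
    · rw [Function.comp_apply, Function.comp_apply, Function.comp_apply, Function.comp_apply, hne]
      rfl
    · refine (List.length_flatMap ..).trans (.trans ?_ (List.length_flatMap ..).symm)
      congr 1
      refine List.map_congr_left fun j _ => ?_
      rw [Function.comp_apply, Function.comp_apply, Function.comp_apply, Function.comp_apply, hne]
      rfl
    · have hblock : ∃ R, keyBlock s β (toLex ((Fin.natAdd p (0 : Fin (r + 1))).castSucc, ⟨1, 1⟩)) =
          toLex (s.g 0, ⟨2, 1⟩) :: R := by
        have hi' : (Fin.natAdd p (0 : Fin (r + 1))).castSucc = s.i := hi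
        rw [keyBlock, ofLex_toLex, if_pos hi', lexKey, key_eq_of_isRightComb hβ, List.finRange_succ]
        exact ⟨_, rfl⟩
      obtain ⟨R, hR⟩ := hblock
      rw [hR, List.cons_append, List.cons_lt_cons_iff]
      refine Or.inl (lt_of_le_of_lt (b := toLex (s.g 0, ⟨1, 1⟩)) (Prod.Lex.toLex_mono ⟨?_, le_rfl⟩)
        (Prod.Lex.toLex_lt_toLex.2 (Or.inr ⟨rfl, Turn.lt_iff.2 (Or.inl Nat.one_lt_two)⟩)))
      change (Fin.natAdd p (0 : Fin (r + b + 1 + 1))).castSucc ≤ s.g 0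
      rw [← s.glue, ← hi]
      exact Fin.le_def.2 (fin_val_le_orderEmbedding s.f (Fin.natAdd p (0 : Fin (r + 1))).castSucc)

end Order

end TreeMonomial

/-! ### Restrictions to subtrees -/

namespace TreeMonomial

variable {X : Type*} {d : X → ℕ}

/-- The leaves of a subtree of a tree monomial, labelled by the branches that are attached to them,
can be renumbered so that the subtree becomes a restriction of the tree monomial. -/
theorem exists_isRestriction {n : ℕ} (α : TreeMonomial X d n)
    {T : OpTree X d (OpTree X d (Fin (n + 1)))} (hT : OpTree.IsBranch (T.bind id) α.tree) :
    ∃ (m : ℕ) (β : TreeMonomial X d m) (u : OpTree X d (Fin (n + 1)) → Fin (m + 1)),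
      β.tree = T.map u ∧ β.IsRestriction α := by
  classical
  have hcan : (T.bind id).IsCanonical := hT.isCanonical α.canonical
  have hnd : (T.bind id).leaves.Nodup := α.nodup.sublist hT.leaves_sublist
  rw [OpTree.leaves_bind, List.nodup_flatMap] at hnd
  -- the minimal leaves
  choose! r R hr using fun S : OpTree X d (Fin (n + 1)) =>
    OpTree.IsCanonical.exists_leaves_eq_cons (t := S)
  have hS : ∀ S ∈ T.leaves, S.IsCanonical := hcan.of_bind
  have hmem : ∀ S ∈ T.leaves, r S ∈ S.leaves := fun S h => by rw [(hr S (hS S h)).1]; simp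
  have hmin : ∀ S ∈ T.leaves, ∀ b ∈ S.leaves, r S ≤ b := fun S h => (hr S (hS S h)).2
  have hnodup : T.leaves.Nodup := by
    refine hnd.2.imp_of_mem fun {S S'} h h' hdis => ?_
    rintro rfl
    exact hdis (hmem S h) (hmem S h)
  have hinj : Set.InjOn r {S | S ∈ T.leaves} := by
    intro S h S' h' e
    by_contra hne
    have : Std.Symm (Function.onFun List.Disjoint
        fun S : OpTree X d (Fin (n + 1)) => (id S).leaves) := ⟨fun _ _ h => List.Disjoint.symm h⟩
    exact hnd.2.forall h h' hne (hmem S h) (e ▸ hmem S' h')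
  have hlen : T.leaves ≠ [] := T.leaves_ne_nil
  obtain ⟨m, hm⟩ : ∃ m, T.leaves.length = m + 1 :=
    ⟨T.leaves.length - 1, by have := List.length_pos_iff.2 hlen; omega⟩
  -- The increasing enumeration of the minimal leaves of the attached branches provides the new
  -- labels.
  let Λ : Finset (Fin (n + 1)) := T.leaves.toFinset.image r
  have hΛ : Λ.card = m + 1 := by
    rw [Finset.card_image_of_injOn (by simpa using hinj), List.toFinset_card_of_nodup hnodup, hm]
  let e : Fin (m + 1) ≃o Λ := Λ.orderIsoOfFin hΛ
  have hrΛ : ∀ S ∈ T.leaves, r S ∈ Λ := fun S h =>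
    Finset.mem_image_of_mem _ (List.mem_toFinset.2 h)
  have hex : ∀ j, ∃ S ∈ T.leaves, r S = e j := fun j => by
    obtain ⟨S, hS, h⟩ := Finset.mem_image.1 (e j).2
    exact ⟨S, List.mem_toFinset.1 hS, h⟩
  choose h hhmem hhr using hex
  -- The value `0` is a dummy: for the leaves of `T` the first case applies.
  let u : OpTree X d (Fin (n + 1)) → Fin (m + 1) := fun S =>
    if hS : r S ∈ Λ then e.symm ⟨r S, hS⟩ else 0
  have hu : ∀ S (hST : S ∈ T.leaves), e (u S) = ⟨r S, hrΛ S hST⟩ := fun S hST => by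
    simp [u, hrΛ S hST]
  have hhu : ∀ S ∈ T.leaves, h (u S) = S := fun S hST =>
    hinj (hhmem _) hST (by rw [hhr, hu S hST])
  have huh : ∀ j, u (h j) = j := fun j => e.injective (Subtype.ext (by
    rw [hu _ (hhmem j)]
    exact hhr j))
  have hlt : ∀ j l, j < l → r (h j) < r (h l) := fun j l hjl => by
    rw [hhr, hhr]
    exact e.strictMono hjl
  refine ⟨m, ⟨T.map u, ?_, fun j => ?_, ?_⟩, u, rfl, ?_⟩
  · rw [OpTree.leaves_map]
    refine hnodup.map_on fun S h1 S' h2 e => ?_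
    rw [← hhu S h1, e, hhu S' h2]
  · rw [OpTree.leaves_map]
    exact List.mem_map.2 ⟨h j, hhmem j, huh j⟩
  · refine hcan.map_of_bind r u hmem hmin fun S h1 S' h2 hSS' => ?_
    rw [← e.lt_iff_lt, hu S h1, hu S' h2]
    exact hSS'
  · refine ⟨_, hT, h, ?_, fun j l hjl => ⟨r (h j), hmem _ (hhmem j), fun b hb =>
      (hlt j l hjl).trans_le (hmin _ (hhmem l) b hb)⟩⟩
    rw [OpTree.map_bind]
    exact OpTree.bind_congr fun S hST => (hhu S hST).symm

theorem IsRestriction.isRightComb {m n : ℕ} {β : TreeMonomial X d m} {α : TreeMonomial X d n}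
    (h : β.IsRestriction α) {l : List X} (hα : α.tree.IsRightComb l) :
    ∃ l', l' <:+: l ∧ β.tree.IsRightComb l' := by
  obtain ⟨u, hu, h, rfl, -⟩ := h
  obtain ⟨l₁, hl₁, hu'⟩ := OpTree.IsRightComb.of_isBranch hu hα
  obtain ⟨l₂, hl₂, hβ⟩ := hu'.of_bind
  exact ⟨l₂, hl₂.isInfix.trans hl₁.isInfix, hβ⟩

/-- A subword is a prefix of a suffix: the suffix is a branch of the comb, and cutting that branch
leaves the prefix. -/
theorem exists_isRestriction_of_infix {n : ℕ} {α : TreeMonomial X d n} {l l' : List X}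
    (hα : α.tree.IsRightComb l) (hl : l' <:+: l) :
    ∃ (m : ℕ) (β : TreeMonomial X d m), β.tree.IsRightComb l' ∧ β.IsRestriction α := by
  obtain ⟨l₁, ⟨l₂, rfl⟩, hl₁⟩ := List.infix_iff_prefix_suffix.1 hl
  obtain ⟨u, hu, hul⟩ := hα.exists_isBranch_of_suffix hl₁
  obtain ⟨T, rfl, hT⟩ := hul.exists_join
  obtain ⟨m, β, r, hβ, hβα⟩ := α.exists_isRestriction hu
  exact ⟨m, β, hβ ▸ hT.map r, hβα⟩

/-- A tree monomial is a right comb if its restrictions to the subtrees with two vertices are. -/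
theorem exists_isRightComb_of_isRestriction {n : ℕ} {α : TreeMonomial X d n}
    (h : ∀ (m : ℕ) (β : TreeMonomial X d m), β.IsRestriction α → β.tree.numVertices = 2 →
      ∃ l, β.tree.IsRightComb l) : ∃ l, α.tree.IsRightComb l := by
  suffices H : ∀ u, OpTree.IsBranch u α.tree → ∃ l, u.IsRightComb l from H _ (.refl _)
  intro u hu
  induction u with
  | leaf a => exact ⟨[], .leaf a⟩
  | node x t ih =>
    have hbr : ∀ j, OpTree.IsBranch (t j) α.tree := fun j =>
      OpTree.IsBranch.trans (.child _ _ _ j (.refl _)) hu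
    obtain ⟨l, hl⟩ := ih (Fin.last _) (hbr _)
    refine ⟨x :: l, .node x t l (fun j hj => ?_) hl⟩
    cases htj : t j with
    | leaf a => exact ⟨a, rfl⟩
    | node y t' =>
      exfalso
      -- The subtree formed by `x` and a vertex `y` on a non-last input violates the hypothesis;
      -- everything above is kept as leaf labels.
      let T : OpTree X d (OpTree X d (Fin (n + 1))) := .node x fun i =>
        if i = j then .node y fun r => .leaf (t' r) else .leaf (t i)
      have hT : T.bind id = .node x t := by
        simp only [T, OpTree.bind]
        congr 1
        funext i
        split_ifs with hi
        · rw [hi, htj]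
          rfl
        · rfl
      have hn : T.numVertices = 2 := by
        simp only [T, OpTree.numVertices]
        rw [Finset.sum_eq_single j]
        · simp [OpTree.numVertices]
        · intro i _ hi
          simp [hi, OpTree.numVertices]
        · simp
      obtain ⟨m, β, r, hβ, hβα⟩ := α.exists_isRestriction (hT ▸ hu)
      obtain ⟨l', hl'⟩ := h m β hβα (by rw [hβ, OpTree.numVertices_map, hn])
      rw [hβ] at hl'
      simp only [T, OpTree.map, OpTree.bind] at hl'
      cases hl' with
      | node _ _ _ hleaf _ =>
        obtain ⟨b, hb⟩ := hleaf j hj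
        simp [OpTree.bind] at hb

end TreeMonomial

/-! ### Words and the free monoid -/

namespace TreeMonomial

variable {X : Type*} {d : X → ℕ}

theorem exists_word (l : FreeMonoid X) : ∃ w : Word X, w.tree.IsRightComb l.toList :=
  exists_isRightComb _ (by simp)

/-- The word with prescribed letters. -/
noncomputable def word (l : FreeMonoid X) : Word X := (exists_word l).choose

theorem isRightComb_word (l : FreeMonoid X) : (word l).tree.IsRightComb l.toList :=
  (exists_word l).choose_spec

theorem eq_word {w : Word X} {l : List X} (h : w.tree.IsRightComb l) :
    w = word (FreeMonoid.ofList l) :=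
  eq_of_isRightComb h (isRightComb_word _)

theorem word_injective : Function.Injective (word : FreeMonoid X → Word X) := fun l l' h => by
  have h1 := (isRightComb_word l).letters_eq
  rw [h, (isRightComb_word l').letters_eq] at h1
  exact FreeMonoid.toList.injective h1.symm

theorem comp_word (s : Shuffle 0 0 0) (l l' : FreeMonoid X) :
    (word l).comp s (word l') = word (l * l') :=
  eq_word (isRightComb_comp (Fin.eq_zero _) (isRightComb_word l) (isRightComb_word l'))

theorem word_one : (word 1 : Word X) = unit := (eq_word isRightComb_unit).symm

theorem word_of (x : X) : word (FreeMonoid.of x) = corolla x := (eq_word (isRightComb_corolla x)).symm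

/-- The ordering of the free monoid that corresponds to an ordering of words. -/
@[reducible] noncomputable def wordOrder (o : LinearOrder (Σ n, TreeMonomial X (fun _ => 0) n)) :
    LinearOrder (FreeMonoid X) :=
  @LinearOrder.lift' _ _ o (fun l => (⟨0, word l⟩ : Σ n, TreeMonomial X (fun _ => 0) n))
    fun l l' h => word_injective (by simpa using h)

/-- Admissibility gives only weak monotonicity; cancellation in the free monoid makes it strict. -/
theorem mulLeftStrictMono_wordOrder {o : LinearOrder (Σ n, TreeMonomial X (fun _ => 0) n)}
    (ho : IsAdmissible o) : letI := wordOrder o; MulLeftStrictMono (FreeMonoid X) :=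
  letI := wordOrder o
  ⟨fun m a b h => by
    refine lt_of_le_of_ne ?_ fun e => h.ne (mul_left_cancel e)
    have := ho.comp_le_comp (Shuffle.last 0 0) (word m) (word m) (word a) (word b)
      (@le_refl _ o.toPreorder _) h.le
    rwa [comp_word, comp_word] at this⟩

theorem mulRightStrictMono_wordOrder {o : LinearOrder (Σ n, TreeMonomial X (fun _ => 0) n)}
    (ho : IsAdmissible o) : letI := wordOrder o; MulRightStrictMono (FreeMonoid X) :=
  letI := wordOrder o
  ⟨fun m a b h => by
    refine lt_of_le_of_ne ?_ fun e => h.ne (mul_right_cancel e)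
    have := ho.comp_le_comp (Shuffle.last 0 0) (word a) (word b) (word m) (word m)
      h.le (@le_refl _ o.toPreorder _)
    rwa [comp_word, comp_word] at this⟩

end TreeMonomial

open TreeMonomial

/-! ### The correspondence between right combs and words -/

section Rightmost

variable {X : Type*} {d : X → ℕ} {B : Set (Word X)}

theorem IsRightmost.exists_isRightComb {n : ℕ} {α : TreeMonomial X d n} {w : Word X}
    (h : IsRightmost B α w) : ∃ l, α.tree.IsRightComb l ∧ w.tree.IsRightComb l := by
  induction h with
  | unit => exact ⟨[], isRightComb_unit, isRightComb_unit⟩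
  | corolla x => exact ⟨[x], isRightComb_corolla x, isRightComb_corolla x⟩
  | comp s hs s₀ α β u v _ _ _ ihα ihβ =>
    obtain ⟨l, hl, hl'⟩ := ihα
    obtain ⟨r, hr, hr'⟩ := ihβ
    exact ⟨l ++ r, isRightComb_comp hs hl hr, isRightComb_comp (Fin.eq_zero _) hl' hr'⟩

theorem IsRightmost.mem (h1 : TreeMonomial.unit ∈ B) (hx : ∀ x, TreeMonomial.corolla x ∈ B) {n : ℕ}
    {α : TreeMonomial X d n} {w : Word X} (h : IsRightmost B α w) : w ∈ B := by
  cases h with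
  | unit => exact h1
  | corolla x => exact hx x
  | comp s hs s₀ α β u v _ _ h => exact h

/-- The comb is built from its top by adding one root at a time; the intermediate words are
suffixes, which is why closure under removal of the first letter suffices. -/
theorem isRightmost_word (hB : ∀ x l, word (FreeMonoid.of x * l) ∈ B → word l ∈ B)
    (l : List X) {n : ℕ} {α : TreeMonomial X d n} (hα : α.tree.IsRightComb l)
    (hl : word (FreeMonoid.ofList l) ∈ B) : IsRightmost B α (word (FreeMonoid.ofList l)) := by
  induction l generalizing n with
  | nil =>
    obtain rfl : n = 0 := by simpa using arity_eq hα
    rw [eq_of_isRightComb hα isRightComb_unit, FreeMonoid.ofList_nil, word_one]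
    exact .unit
  | cons x l ih =>
    rw [FreeMonoid.ofList_cons] at hl ⊢
    obtain ⟨α', hα'⟩ := TreeMonomial.exists_isRightComb (d := d) l rfl
    obtain rfl : n = d x + (l.map d).sum := by simpa using arity_eq hα
    rw [eq_of_isRightComb hα (isRightComb_comp (Shuffle.last_i _ _) (isRightComb_corolla x) hα'),
      ← comp_word (Shuffle.last 0 0), word_of]
    refine .comp _ (Shuffle.last_i _ _) _ _ _ _ _ (.corolla x) (ih hα' (hB x _ hl)) ?_
    rwa [← word_of, comp_word]

end Rightmost

section TriangularBasis

variable {K : Type*} [Field K] {X : Type*} {P : ShuffleOperad K}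
  {φ : (freeOperad K X fun _ => 0).Hom P} {o : LinearOrder (Σ n, TreeMonomial X (fun _ => 0) n)}
  {k : ℕ} {B : ∀ n, Set (TreeMonomial X (fun _ => 0) n)}

/-- A word belongs to a triangular basis if and only if its short subwords do. -/
theorem IsTriangularBasis.word_mem_iff (hB : IsTriangularBasis φ o k B) (l : List X) :
    word (FreeMonoid.ofList l) ∈ B 0 ↔ ∀ l', l' <:+: l → 1 ≤ l'.length → l'.length ≤ k →
      word (FreeMonoid.ofList l') ∈ B 0 := by
  rw [hB.mem_iff]
  constructor
  · intro h l' hl' h1 hk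
    obtain ⟨m, β, hβ, hβα⟩ := exists_isRestriction_of_infix (isRightComb_word _) hl'
    obtain rfl : m = 0 := by simpa using arity_eq hβ
    rw [← eq_word hβ]
    exact h β hβα (by rwa [hβ.numVertices_eq]) (by rwa [hβ.numVertices_eq])
  · intro h m β hβ h1 hk
    obtain ⟨l', hl', hβl⟩ := hβ.isRightComb (isRightComb_word _)
    obtain rfl : m = 0 := by simpa using arity_eq hβl
    rw [eq_word hβl]
    rw [hβl.numVertices_eq] at h1 hk
    exact h l' hl' h1 hk

theorem IsTriangularBasis.word_mem_of_infix (hB : IsTriangularBasis φ o k B) {l l' : List X}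
    (hl : word (FreeMonoid.ofList l) ∈ B 0) (h : l' <:+: l) :
    word (FreeMonoid.ofList l') ∈ B 0 := by
  rw [hB.word_mem_iff] at hl ⊢
  exact fun r hr => hl r (hr.trans h)

/-- The empty word has no subwords of positive length, so condition (3) is vacuous. -/
theorem IsTriangularBasis.word_one_mem (hB : IsTriangularBasis φ o k B) :
    (word 1 : Word X) ∈ B 0 :=
  (hB.word_mem_iff []).2 fun l' hl' h1 _ => by simp [List.infix_nil.1 hl'] at h1

theorem IsTriangularBasis.isRightmost_word (hB : IsTriangularBasis φ o k B) {d : X → ℕ}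
    {l : List X} {n : ℕ} {α : TreeMonomial X d n} (hα : α.tree.IsRightComb l)
    (hl : word (FreeMonoid.ofList l) ∈ B 0) : IsRightmost (B 0) α (word (FreeMonoid.ofList l)) :=
  _root_.isRightmost_word (fun x l h => hB.word_mem_of_infix (l := x :: l.toList) h
    (List.suffix_cons _ _).isInfix) l hα hl

theorem IsTriangularBasis.mem_of_isRightmost (hB : IsTriangularBasis φ o k B) {d : X → ℕ} {n : ℕ}
    {α : TreeMonomial X d n} {w : Word X} (h : IsRightmost (B 0) α w) : w ∈ B 0 :=
  h.mem (word_one (X := X) ▸ hB.word_one_mem) hB.corolla_mem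

theorem IsTriangularBasis.mem_rightmostSet_iff (hB : IsTriangularBasis φ o k B) {d : X → ℕ} {n : ℕ}
    {α : TreeMonomial X d n} : α ∈ rightmostSet d (B 0) n ↔
      ∃ l, α.tree.IsRightComb l ∧ word (FreeMonoid.ofList l) ∈ B 0 := by
  constructor
  · rintro ⟨w, hw⟩
    obtain ⟨l, hα, hl⟩ := hw.exists_isRightComb
    exact ⟨l, hα, eq_word hl ▸ hB.mem_of_isRightmost hw⟩
  · rintro ⟨l, hα, hl⟩
    exact ⟨_, hB.isRightmost_word hα hl⟩

/-- The correspondence between right combs and words is onto. -/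
theorem IsTriangularBasis.mem_iff_exists_isRightmost (hB : IsTriangularBasis φ o k B) (d : X → ℕ)
    (w : Word X) : w ∈ B 0 ↔ ∃ p : Σ n, TreeMonomial X d n, IsRightmost (B 0) p.2 w := by
  constructor
  · intro hw
    have hl := w.tree.isRightComb_letters
    rw [eq_word hl] at hw ⊢
    obtain ⟨α, hα⟩ := TreeMonomial.exists_isRightComb (d := d) w.tree.letters rfl
    exact ⟨⟨_, α⟩, hB.isRightmost_word hα hw⟩
  · rintro ⟨p, hp⟩
    exact hB.mem_of_isRightmost hp

/-- The correspondence between right combs and words is well-defined and one-to-one. -/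
theorem IsRightmost.eq_iff_eq {d : X → ℕ} {B : Set (Word X)} {p q : Σ n, TreeMonomial X d n}
    {u w : Word X} (hp : IsRightmost B p.2 u) (hq : IsRightmost B q.2 w) : p = q ↔ u = w := by
  obtain ⟨l, hl, hu⟩ := hp.exists_isRightComb
  obtain ⟨r, hr, hw⟩ := hq.exists_isRightComb
  constructor
  · rintro rfl
    obtain rfl : l = r := hl.letters_eq.symm.trans hr.letters_eq
    exact eq_of_isRightComb hu hw
  · rintro rfl
    obtain rfl : l = r := hu.letters_eq.symm.trans hw.letters_eq
    obtain ⟨n, α⟩ := p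
    obtain ⟨m, β⟩ := q
    obtain rfl : n = m := (arity_eq hl).trans (arity_eq hr).symm
    exact congrArg (Sigma.mk n) (eq_of_isRightComb hl hr)

/-- Membership in the set of right combs is decided by the subtrees with at most `k` vertices. -/
theorem IsTriangularBasis.mem_rightmostSet_iff_forall (hB : IsTriangularBasis φ o k B) (hk : 2 ≤ k)
    {d : X → ℕ} {n : ℕ} (α : TreeMonomial X d n) : α ∈ rightmostSet d (B 0) n ↔
      ∀ {m : ℕ} (β : TreeMonomial X d m), β.IsRestriction α →
        1 ≤ β.tree.numVertices → β.tree.numVertices ≤ k → β ∈ rightmostSet d (B 0) m := by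
  constructor
  · intro hα m β hβ _ _
    obtain ⟨l, hl, hlB⟩ := hB.mem_rightmostSet_iff.1 hα
    obtain ⟨l', hl', hβl⟩ := hβ.isRightComb hl
    exact hB.mem_rightmostSet_iff.2 ⟨l', hβl, hB.word_mem_of_infix hlB hl'⟩
  · intro h
    -- Subtrees with two vertices are among those tested because `2 ≤ k`.
    obtain ⟨l, hl⟩ := exists_isRightComb_of_isRestriction fun m β hβ h2 => by
      obtain ⟨l, hl, -⟩ := hB.mem_rightmostSet_iff.1 (h β hβ (by omega) (by omega))
      exact ⟨l, hl⟩
    refine hB.mem_rightmostSet_iff.2 ⟨l, hl, (hB.word_mem_iff l).2 fun l' hl' h1 hk' => ?_⟩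
    obtain ⟨m, β, hβ, hβα⟩ := exists_isRestriction_of_infix hl hl'
    obtain ⟨r, hr, hrB⟩ := hB.mem_rightmostSet_iff.1
      (h β hβα (by rwa [hβ.numVertices_eq]) (by rwa [hβ.numVertices_eq]))
    rwa [← hr.letters_eq, hβ.letters_eq] at hrB

end TriangularBasis

/-! ### Evaluation in the algebra, bases and triangularity -/

theorem freeOperad_comp_single {K : Type*} [Field K] {X : Type*} {d : X → ℕ} {a b c : ℕ}
    (s : Shuffle a b c) (α : TreeMonomial X d a) (β : TreeMonomial X d b) :
    (freeOperad K X d).comp s (Finsupp.single α (1 : K)) (Finsupp.single β (1 : K)) =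
      Finsupp.single (α.comp s β) (1 : K) :=
  (linearCombination_comp_single s α β 1 1).trans (by rw [mul_one])

/-- The inclusion of a component of the operad of an algebra. -/
def unaryOperadVal (K A : Type*) [Field K] [Ring A] [Algebra K A] (n : ℕ) :
    (unaryOperad K A).P n →ₗ[K] A :=
  Submodule.subtype _

theorem unaryOperadVal_injective (K A : Type*) [Field K] [Ring A] [Algebra K A] (n : ℕ) :
    Function.Injective (unaryOperadVal K A n) :=
  Subtype.val_injective

theorem unaryOperadVal_surjective (K A : Type*) [Field K] [Ring A] [Algebra K A] :
    Function.Surjective (unaryOperadVal K A 0) := fun a => ⟨⟨a, by simp⟩, rfl⟩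

section Commutative

variable {K A : Type*} [Field K] [CommRing A] [Algebra K A] (𝒜 : ℕ → Submodule K A)
  [GradedAlgebra 𝒜]

/-- The inclusion of a component of the operad of a commutative graded algebra. -/
def commOperadVal (n : ℕ) : (commOperad 𝒜).P n →ₗ[K] A := (𝒜 n).subtype

theorem commOperadVal_injective (n : ℕ) : Function.Injective (commOperadVal 𝒜 n) :=
  Subtype.val_injective

variable {X : Type*} {d : X → ℕ} {v : X → A}

theorem prod_letters_mem (hv : ∀ x, v x ∈ 𝒜 (d x)) {n : ℕ} (α : TreeMonomial X d n) :
    (α.tree.letters.map v).prod ∈ 𝒜 n := by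
  have h : n = (α.tree.letters.map d).sum := by
    have := α.tree.length_leaves
    rw [α.length_leaves] at this
    omega
  have hmem := SetLike.list_prod_map_mem_graded (A := 𝒜) α.tree.letters d v fun x _ => hv x
  rwa [← h] at hmem

/-- Each input of `α` occurs exactly once as a leaf, so `β` contributes exactly one factor. -/
theorem prod_letters_comp {a b c : ℕ} (s : Shuffle a b c) (α : TreeMonomial X d a)
    (β : TreeMonomial X d b) : ((α.comp s β).tree.letters.map v).prod =
      (α.tree.letters.map v).prod * (β.tree.letters.map v).prod := by
  have hg : ∀ j, ((graft s β j).letters.map v).prod =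
      if j = s.i then (β.tree.letters.map v).prod else 1 := by
    intro j
    unfold graft
    split_ifs
    · rw [OpTree.map, OpTree.prod_letters_bind]
      simp [OpTree.letters]
    · rfl
  have huniv : α.tree.leaves.toFinset = Finset.univ := by
    ext a
    simp [α.mem_leaves a]
  rw [comp, OpTree.prod_letters_bind, ← List.prod_toFinset _ α.nodup, huniv]
  simp [hg]

/-- The value of a combination of tree monomials in a commutative algebra. -/
noncomputable def treeEval (K : Type*) [Field K] [Algebra K A] (v : X → A) (n : ℕ) :
    (TreeMonomial X d n →₀ K) →ₗ[K] A :=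
  Finsupp.linearCombination K fun α => (α.tree.letters.map v).prod

theorem treeEval_single {n : ℕ} (α : TreeMonomial X d n) (r : K) :
    treeEval K v n (Finsupp.single α r) = r • (α.tree.letters.map v).prod :=
  Finsupp.linearCombination_single ..

theorem treeEval_mem (hv : ∀ x, v x ∈ 𝒜 (d x)) {n : ℕ} (e : TreeMonomial X d n →₀ K) :
    treeEval K v n e ∈ 𝒜 n := by
  rw [treeEval, Finsupp.linearCombination_apply]
  exact Submodule.sum_mem _ fun α _ => Submodule.smul_mem _ _ (prod_letters_mem 𝒜 hv α)

theorem treeEval_comp {a b c : ℕ} (s : Shuffle a b c) (x : TreeMonomial X d a →₀ K)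
    (y : TreeMonomial X d b →₀ K) : treeEval K v c (Finsupp.linearCombination K
      (fun α => Finsupp.lmapDomain K K (TreeMonomial.comp s α)) x y) =
        treeEval K v a x * treeEval K v b y := by
  induction x using Finsupp.induction_linear with
  | zero => simp
  | add x x' hx hx' => simp only [map_add, LinearMap.add_apply, hx, hx', add_mul]
  | single α r =>
    induction y using Finsupp.induction_linear with
    | zero => simp
    | add y y' hy hy' => simp only [map_add, hy, hy', mul_add]
    | single β r' =>
      rw [linearCombination_comp_single, treeEval_single, treeEval_single, treeEval_single,
        prod_letters_comp, smul_mul_smul_comm]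

/-- The morphism from a free operad that is determined by homogeneous elements of the algebra. -/
noncomputable def commOperadLift (hv : ∀ x, v x ∈ 𝒜 (d x)) :
    (freeOperad K X d).Hom (commOperad 𝒜) where
  map n := LinearMap.codRestrict (𝒜 n) (treeEval K v n) fun e => treeEval_mem 𝒜 hv e
  map_one := Subtype.ext ((treeEval_single TreeMonomial.unit (1 : K)).trans (one_smul K _))
  map_comp s x y := Subtype.ext (treeEval_comp s x y)

theorem commOperadVal_lift (hv : ∀ x, v x ∈ 𝒜 (d x)) {n : ℕ} (e : TreeMonomial X d n →₀ K) :
    commOperadVal 𝒜 n ((commOperadLift 𝒜 hv).map n e) = treeEval K v n e :=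
  rfl

theorem commOperadVal_lift_single (hv : ∀ x, v x ∈ 𝒜 (d x)) {n : ℕ} (α : TreeMonomial X d n) :
    commOperadVal 𝒜 n ((commOperadLift 𝒜 hv).map n (Finsupp.single α (1 : K))) =
      (α.tree.letters.map v).prod :=
  (treeEval_single α (1 : K)).trans (one_smul K _)

theorem unaryOperadVal_hom_single (φ : (freeOperad K X fun _ => 0).Hom (unaryOperad K A))
    (hφ : ∀ x, (φ.map 0 (Finsupp.single (TreeMonomial.corolla x) 1)).1 = v x) (w : Word X) :
    unaryOperadVal K A 0 (φ.map 0 (Finsupp.single w (1 : K))) = (w.tree.letters.map v).prod := by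
  have hl := w.tree.isRightComb_letters
  generalize w.tree.letters = l at hl
  rw [eq_word hl]
  clear hl
  induction l with
  | nil =>
    rw [FreeMonoid.ofList_nil, word_one]
    exact congrArg Subtype.val φ.map_one
  | cons x l ih =>
    have h := (congrArg (φ.map 0) (freeOperad_comp_single (Shuffle.last 0 0)
      (word (FreeMonoid.of x)) (word (FreeMonoid.ofList l))).symm).trans (φ.map_comp _ _ _)
    rw [FreeMonoid.ofList_cons, ← comp_word (Shuffle.last 0 0), h, List.map_cons, List.prod_cons,
      ← ih, ← hφ, ← word_of]
    rfl

theorem unaryOperadVal_hom (φ : (freeOperad K X fun _ => 0).Hom (unaryOperad K A))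
    (hφ : ∀ x, (φ.map 0 (Finsupp.single (TreeMonomial.corolla x) 1)).1 = v x) (e : Word X →₀ K) :
    unaryOperadVal K A 0 (φ.map 0 e) = treeEval K v 0 e := by
  let Φ : (Word X →₀ K) →ₗ[K] A := (unaryOperadVal K A 0).comp (φ.map 0)
  have h : Φ = treeEval K v 0 := Finsupp.lhom_ext' fun w => LinearMap.ext_ring <|
    (unaryOperadVal_hom_single φ hφ w).trans
      ((treeEval_single w (1 : K)).trans (one_smul K _)).symm
  exact LinearMap.congr_fun h e

/-- The homogeneous components of a combination of words are combinations of right combs. -/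
theorem decompose_mem_span (hv : ∀ x, v x ∈ 𝒜 (d x)) (Q : Set (List X)) {x : A}
    (hx : x ∈ Submodule.span K ((fun l : List X => (l.map v).prod) '' Q)) (n : ℕ) :
    (DirectSum.decompose 𝒜 x n : A) ∈ Submodule.span K
      ((fun α : TreeMonomial X d n => (α.tree.letters.map v).prod) ''
        {α | ∃ l ∈ Q, α.tree.IsRightComb l}) := by
  induction hx using Submodule.span_induction with
  | mem x hx =>
    obtain ⟨l, hl, rfl⟩ := hx
    have hmem : (l.map v).prod ∈ 𝒜 (l.map d).sum :=
      SetLike.list_prod_map_mem_graded _ _ _ fun x _ => hv x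
    by_cases hn : (l.map d).sum = n
    · subst hn
      obtain ⟨α, hα⟩ := TreeMonomial.exists_isRightComb (d := d) l rfl
      rw [DirectSum.decompose_of_mem_same _ hmem]
      exact Submodule.subset_span ⟨α, ⟨l, hl, hα⟩, by simp only [hα.letters_eq]⟩
    · rw [DirectSum.decompose_of_mem_ne _ hmem hn]
      exact Submodule.zero_mem _
  | zero => simp
  | add x y _ _ hx hy => simpa using Submodule.add_mem _ hx hy
  | smul r x _ hx =>
    rw [DirectSum.decompose_smul, DirectSum.smul_apply]
    exact Submodule.smul_mem _ r hx

variable {o : LinearOrder (Σ n, TreeMonomial X (fun _ => 0) n)}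
  {k : ℕ} {B : ∀ n, Set (TreeMonomial X (fun _ => 0) n)}
  {φ : (freeOperad K X fun _ => 0).Hom (unaryOperad K A)}

theorem linearIndependent_words
    (hφ : ∀ x, (φ.map 0 (Finsupp.single (TreeMonomial.corolla x) 1)).1 = v x)
    (hB : IsTriangularBasis φ o k B) :
    LinearIndependent K fun w : B 0 => ((w : Word X).tree.letters.map v).prod := by
  have h0 := (hB.linearIndependent 0).map' (unaryOperadVal K A 0)
    (LinearMap.ker_eq_bot.2 (unaryOperadVal_injective K A 0))
  have hfun : (unaryOperadVal K A 0 ∘ fun w : B 0 => φ.map 0 (Finsupp.single (w : Word X) (1 : K))) =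
      fun w : B 0 => ((w : Word X).tree.letters.map v).prod :=
    funext fun w => unaryOperadVal_hom_single φ hφ w
  exact hfun ▸ h0

/-- Distinct combs of one arity have distinct words, so this family is a subfamily of the
independent family indexed by `B 0`. -/
theorem linearIndependent_prod_letters
    (hφ : ∀ x, (φ.map 0 (Finsupp.single (TreeMonomial.corolla x) 1)).1 = v x)
    (hB : IsTriangularBasis φ o k B) (n : ℕ) :
    LinearIndependent K fun α : rightmostSet d (B 0) n =>
      ((α : TreeMonomial X d n).tree.letters.map v).prod := by
  choose l hl hlB using fun α : rightmostSet d (B 0) n => hB.mem_rightmostSet_iff.1 α.2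
  have hinj : Function.Injective fun α =>
      (⟨word (FreeMonoid.ofList (l α)), hlB α⟩ : B 0) := fun α β h => by
    have h' : l α = l β := word_injective (congrArg Subtype.val h)
    exact Subtype.ext (eq_of_isRightComb (hl α) (h' ▸ hl β))
  have hfun : (fun w : B 0 => ((w : Word X).tree.letters.map v).prod) ∘
      (fun α => ⟨word (FreeMonoid.ofList (l α)), hlB α⟩) =
      fun α : rightmostSet d (B 0) n => ((α : TreeMonomial X d n).tree.letters.map v).prod := by
    funext α
    have := (isRightComb_word (FreeMonoid.ofList (l α))).letters_eq
    rw [Function.comp_apply, (hl α).letters_eq, this]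
    rfl
  exact hfun ▸ (linearIndependent_words hφ hB).comp _ hinj

theorem linearIndependent_rightmostSet (hv : ∀ x, v x ∈ 𝒜 (d x))
    (hφ : ∀ x, (φ.map 0 (Finsupp.single (TreeMonomial.corolla x) 1)).1 = v x)
    (hB : IsTriangularBasis φ o k B) (n : ℕ) :
    LinearIndependent K fun α : rightmostSet d (B 0) n =>
      (commOperadLift 𝒜 hv).map n (Finsupp.single (α : TreeMonomial X d n) (1 : K)) := by
  refine LinearIndependent.of_comp (commOperadVal 𝒜 n) ?_
  have hfun : (commOperadVal 𝒜 n ∘ fun α : rightmostSet d (B 0) n =>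
      (commOperadLift 𝒜 hv).map n (Finsupp.single (α : TreeMonomial X d n) (1 : K))) =
      fun α : rightmostSet d (B 0) n => ((α : TreeMonomial X d n).tree.letters.map v).prod :=
    funext fun α => commOperadVal_lift_single 𝒜 hv _
  exact hfun ▸ linearIndependent_prod_letters hφ hB n

theorem span_words_eq_top (hφ : ∀ x, (φ.map 0 (Finsupp.single (TreeMonomial.corolla x) 1)).1 = v x)
    (hB : IsTriangularBasis φ o k B) : Submodule.span K ((fun l : List X => (l.map v).prod) ''
      {l | word (FreeMonoid.ofList l) ∈ B 0}) = ⊤ := by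
  have h := congrArg (Submodule.map (unaryOperadVal K A 0)) (hB.span_eq_top 0)
  rw [Submodule.map_top, LinearMap.range_eq_top.2 (unaryOperadVal_surjective K A),
    Submodule.map_span] at h
  rw [eq_top_iff, ← h]
  refine Submodule.span_mono ?_
  rintro _ ⟨_, ⟨⟨w, hw⟩, rfl⟩, rfl⟩
  refine ⟨w.tree.letters, ?_, (unaryOperadVal_hom_single φ hφ w).symm⟩
  rwa [eq_word w.tree.isRightComb_letters] at hw

/-- A homogeneous element is a combination of words from `B 0`; its component of degree `n` is
itself, while that of each word is the word or zero. -/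
theorem span_rightmostSet_eq_top (hv : ∀ x, v x ∈ 𝒜 (d x))
    (hφ : ∀ x, (φ.map 0 (Finsupp.single (TreeMonomial.corolla x) 1)).1 = v x)
    (hB : IsTriangularBasis φ o k B) (n : ℕ) :
    Submodule.span K (Set.range fun α : rightmostSet d (B 0) n =>
      (commOperadLift 𝒜 hv).map n (Finsupp.single (α : TreeMonomial X d n) (1 : K))) = ⊤ := by
  rw [eq_top_iff]
  rintro x -
  have hx : commOperadVal 𝒜 n x ∈ Submodule.span K ((fun l : List X => (l.map v).prod) ''
      {l | word (FreeMonoid.ofList l) ∈ B 0}) := by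
    rw [span_words_eq_top hφ hB]
    trivial
  have h := decompose_mem_span (d := d) 𝒜 hv _ hx n
  rw [DirectSum.decompose_of_mem_same 𝒜 (show commOperadVal 𝒜 n x ∈ 𝒜 n from x.2)] at h
  suffices H : commOperadVal 𝒜 n x ∈ Submodule.map (commOperadVal 𝒜 n) (Submodule.span K
      (Set.range fun α : rightmostSet d (B 0) n =>
        (commOperadLift 𝒜 hv).map n (Finsupp.single (α : TreeMonomial X d n) (1 : K)))) by
    obtain ⟨y, hy, hyx⟩ := H
    exact commOperadVal_injective 𝒜 n hyx ▸ hy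
  rw [Submodule.map_span]
  refine Submodule.span_mono ?_ h
  rintro _ ⟨α, ⟨l, hl, hα⟩, rfl⟩
  exact ⟨_, ⟨⟨α, hB.mem_rightmostSet_iff.2 ⟨l, hα, hl⟩⟩, rfl⟩, commOperadVal_lift_single 𝒜 hv α⟩

theorem triangular_rightmostSet (hd : ∀ x, 0 < d x) (hv : ∀ x, v x ∈ 𝒜 (d x))
    (hφ : ∀ x, (φ.map 0 (Finsupp.single (TreeMonomial.corolla x) 1)).1 = v x)
    (hB : IsTriangularBasis φ o k B) {a b c : ℕ} (s : Shuffle a b c) (α : TreeMonomial X d a)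
    (β : TreeMonomial X d b) (hα : α ∈ rightmostSet d (B 0) a) (hβ : β ∈ rightmostSet d (B 0) b) :
    let _ := wordOrder o
    α.comp s β ∈ rightmostSet d (B 0) c ∨
      ∃ e : TreeMonomial X d c →₀ K, (∀ γ ∈ e.support, γ ∈ rightmostSet d (B 0) c) ∧
        (commOperadLift 𝒜 hv).map c (Finsupp.single (α.comp s β) (1 : K)) =
          (commOperadLift 𝒜 hv).map c e ∧
        ∀ γ ∈ e.support, γ < α.comp s β := by
  let _ := wordOrder o
  rw [or_iff_not_imp_left]
  intro hnot
  obtain ⟨l₁, hl₁, h₁⟩ := hB.mem_rightmostSet_iff.1 hα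
  obtain ⟨l₂, hl₂, h₂⟩ := hB.mem_rightmostSet_iff.1 hβ
  -- The comb `δ` has the same value as the composition and is not larger, so it can be expanded
  -- instead.
  obtain ⟨δ, hδ⟩ := TreeMonomial.exists_isRightComb (d := d) (n := c) (l₁ ++ l₂) (by
    rw [← s.degree_eq, arity_eq hl₁, arity_eq hl₂, List.map_append, List.sum_append])
  have hle : δ ≤ α.comp s β := le_comp_of_isRightComb hd s hl₁ hl₂ hδ
  have hval : ((α.comp s β).tree.letters.map v).prod = ((l₁ ++ l₂).map v).prod := by
    rw [prod_letters_comp, hl₁.letters_eq, hl₂.letters_eq, List.map_append, List.prod_append]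
  by_cases hmem : word (FreeMonoid.ofList (l₁ ++ l₂)) ∈ B 0
  · have hδB := hB.mem_rightmostSet_iff.2 ⟨_, hδ, hmem⟩
    have hsupp : ∀ γ ∈ (Finsupp.single δ (1 : K)).support, γ = δ := fun γ hγ => by
      simpa using Finsupp.support_single_subset hγ
    refine ⟨Finsupp.single δ 1, fun γ hγ => hsupp γ hγ ▸ hδB,
      commOperadVal_injective 𝒜 c ?_, fun γ hγ => ?_⟩
    · rw [commOperadVal_lift_single, commOperadVal_lift_single, hval, hδ.letters_eq]
    · rw [hsupp γ hγ]
      exact lt_of_le_of_ne hle fun h => hnot (h ▸ hδB)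
  · rcases hB.triangular (Shuffle.last 0 0) _ _ h₁ h₂ with h | ⟨e, heB, he, hlt⟩
    · rw [comp_word] at h
      exact absurd h hmem
    rw [comp_word] at he hlt
    have hspan : ((l₁ ++ l₂).map v).prod ∈ Submodule.span K
        ((fun l : List X => (l.map v).prod) '' {l | word (FreeMonoid.ofList l) ∈ B 0 ∧
          FreeMonoid.ofList l < FreeMonoid.ofList (l₁ ++ l₂)}) := by
      have he' := congrArg (unaryOperadVal K A 0) he
      rw [unaryOperadVal_hom_single φ hφ, unaryOperadVal_hom φ hφ,
        (isRightComb_word _).letters_eq] at he'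
      refine (show ((l₁ ++ l₂).map v).prod = _ from he') ▸ ?_
      rw [treeEval, Finsupp.linearCombination_apply]
      refine Submodule.sum_mem _ fun γ hγ => Submodule.smul_mem _ _ (Submodule.subset_span
        ⟨γ.tree.letters, ?_, rfl⟩)
      have hw := eq_word γ.tree.isRightComb_letters
      have h1 := heB γ hγ
      have h2 := hlt γ hγ
      rw [hw] at h1 h2
      exact ⟨h1, h2⟩
    -- Words of other degrees may occur in `e`; taking the component of degree `c` discards them and
    -- turns the others into combs of the right arity.
    have h := decompose_mem_span (d := d) 𝒜 hv _ hspan c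
    rw [DirectSum.decompose_of_mem_same 𝒜 (hval ▸ prod_letters_mem 𝒜 hv (α.comp s β)),
      Finsupp.mem_span_image_iff_linearCombination] at h
    obtain ⟨e', he', heq⟩ := h
    have hsupp : ∀ γ ∈ e'.support, ∃ l, (word (FreeMonoid.ofList l) ∈ B 0 ∧
        FreeMonoid.ofList l < FreeMonoid.ofList (l₁ ++ l₂)) ∧ γ.tree.IsRightComb l := fun γ hγ =>
      (Finsupp.mem_supported K e').1 he' hγ
    refine ⟨e', fun γ hγ => ?_, commOperadVal_injective 𝒜 c ?_, fun γ hγ => ?_⟩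
    · obtain ⟨l, ⟨hl, -⟩, hγl⟩ := hsupp γ hγ
      exact hB.mem_rightmostSet_iff.2 ⟨l, hγl, hl⟩
    · rw [commOperadVal_lift_single, hval, commOperadVal_lift]
      exact heq.symm
    · obtain ⟨l, ⟨-, hl⟩, hγl⟩ := hsupp γ hγ
      exact (lt_of_isRightComb hγl hδ hl).trans_le hle

end Commutative

theorem mainTheorem6 {K : Type*} [Field K] {A : Type*} [CommRing A] [Algebra K A]
    (𝒜 : ℕ → Submodule K A) [GradedAlgebra 𝒜]
    {X : Type*} (d : X → ℕ) (hd : ∀ x, 0 < d x)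
    (v : X → A) (hv : ∀ x, v x ∈ 𝒜 (d x))
    (k : ℕ) (hk : 2 ≤ k)
    (φ : (freeOperad K X fun _ => 0).Hom (unaryOperad K A))
    (hφ : ∀ x, (φ.map 0 (Finsupp.single (TreeMonomial.corolla x) 1)).1 = v x)
    (o : LinearOrder (Σ n, TreeMonomial X (fun _ => 0) n)) (ho : IsAdmissible o)
    (B : ∀ n, Set (TreeMonomial X (fun _ => 0) n)) (hB : IsTriangularBasis φ o k B) :
    (∀ w, w ∈ B 0 ↔ ∃ p : Σ n, TreeMonomial X d n, IsRightmost (B 0) p.2 w) ∧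
    (∀ (p q : Σ n, TreeMonomial X d n) (u w : Word X),
      IsRightmost (B 0) p.2 u → IsRightmost (B 0) q.2 w → (p = q ↔ u = w)) ∧
    ∃ ψ : (freeOperad K X d).Hom (commOperad 𝒜),
      (∀ x, (ψ.map (d x) (Finsupp.single (TreeMonomial.corolla x) 1)).1 = v x) ∧
      ∃ o' : LinearOrder (Σ n, TreeMonomial X d n),
        IsAdmissible o' ∧ IsTriangularBasis ψ o' k (rightmostSet d (B 0)) := by
  let _ := wordOrder o
  have := mulLeftStrictMono_wordOrder ho
  have := mulRightStrictMono_wordOrder ho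
  refine ⟨hB.mem_iff_exists_isRightmost d, fun p q u w hp hq => hp.eq_iff_eq hq,
    commOperadLift 𝒜 hv, fun x => ?_, sigmaOrder X d, isAdmissible_sigmaOrder, ?_⟩
  · refine (commOperadVal_lift_single 𝒜 hv (TreeMonomial.corolla x)).trans ?_
    simp [(isRightComb_corolla x).letters_eq]
  · refine ⟨fun x => ⟨_, .corolla x⟩, linearIndependent_rightmostSet 𝒜 hv hφ hB,
      span_rightmostSet_eq_top 𝒜 hv hφ hB, fun s α β hα hβ => ?_,
      hB.mem_rightmostSet_iff_forall hk⟩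
    simp only [sigmaOrder_lt_iff]
    exact triangular_rightmostSet 𝒜 hd hv hφ hB s α β hα hβ
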